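/- Let $k$ be an arbitrary field and let $n\ge 1$. A (not necessarily associative) $k$-algebra is called right-symmetric if it satisfies the identity $(xy)z-x(yz)=(xz)y-x(zy)$. Let $A=RS\langle x_1,\dots,x_n\rangle$ be the free right-symmetric $k$-algebra with identity element in the variables $x_1,\dots,x_n$, and let $RS\langle x_1,\dots,x_{n-1}\rangle$ be its subalgebra (with $1$) generated by $x_1,\dots,x_{n-1}$, so that it equals $k$ when $n=1$. For $f\in A$ let $(f)$ denote the two-sided ideal of $A$ generated by $f$. Theorem (Freiheitssatz). If $f\in RS\langle x_1,\dots,x_n\rangle$ and $f\notin RS\langle x_1,\dots,x_{n-1}\rangle$, then $(f)\cap RS\langle x_1,\dots,x_{n-1}\rangle=0$. -/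

import Mathlib

/-- The free unital nonassociative algebra over `k` on `X`: the algebra with basis the set of all
nonassociative words in the alphabet `X`, including the empty word `1`. -/
abbrev FreeUnitalNonAssocAlgebra (k X : Type*) [Field k] : Type _ :=
  MonoidAlgebra k (WithOne (FreeMagma X))

/-- The right-symmetric identity `(ab)c - a(bc) = (ac)b - a(cb)`, as a relation on the free unital
nonassociative algebra. -/
inductive RightSymmetricRel (k X : Type*) [Field k] :
    FreeUnitalNonAssocAlgebra k X → FreeUnitalNonAssocAlgebra k X → Prop
  | right_symm (a b c : FreeUnitalNonAssocAlgebra k X) :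
      RightSymmetricRel k X ((a * b) * c - a * (b * c)) ((a * c) * b - a * (c * b))

/-- The free (unital) right-symmetric algebra `RS⟨X⟩` over the field `k`: the quotient of the free
unital nonassociative algebra by the smallest congruence that forces the right-symmetric identity.
(A ring congruence of a unital algebra respects scalars, since `r • a = (r • 1) * a`.) -/
abbrev FreeRightSymmetricAlgebra (k X : Type*) [Field k] : Type _ :=
  (ringConGen (RightSymmetricRel k X)).Quotient

namespace FreeRightSymmetricAlgebra

noncomputable instance instModule (k X : Type*) [Field k] : Module k (FreeRightSymmetricAlgebra k X) where
  add_smul r s := by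
    rintro ⟨a⟩
    exact congrArg (RingCon.toQuotient (c := ringConGen (RightSymmetricRel k X)))
      (add_smul r s a)
  zero_smul := by
    rintro ⟨a⟩
    exact congrArg (RingCon.toQuotient (c := ringConGen (RightSymmetricRel k X)))
      (zero_smul k a)

/-- The variable `x_i` of `RS⟨X⟩`. -/
noncomputable def var (k : Type*) {X : Type*} [Field k] (i : X) : FreeRightSymmetricAlgebra k X :=
  RingCon.toQuotient (c := ringConGen (RightSymmetricRel k X))
    (MonoidAlgebra.single ((FreeMagma.of i : FreeMagma X) : WithOne (FreeMagma X)) 1)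

/-- The subalgebra (with `1`) of `RS⟨X⟩` generated by the variables in `S`. It is the canonical
copy of `RS⟨S⟩` in `RS⟨X⟩`. -/
noncomputable def varSubalgebra (k : Type*) {X : Type*} [Field k] (S : Set X) :
    NonUnitalSubalgebra k (FreeRightSymmetricAlgebra k X) :=
  NonUnitalAlgebra.adjoin k (insert 1 (var k '' S))

/-- `RS⟨X⟩` satisfies the right-symmetric identity. -/
theorem right_symm {k X : Type*} [Field k] (a b c : FreeRightSymmetricAlgebra k X) :
    (a * b) * c - a * (b * c) = (a * c) * b - a * (c * b) := by
  obtain ⟨a⟩ := a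
  obtain ⟨b⟩ := b
  obtain ⟨c⟩ := c
  exact Quotient.sound (RingConGen.Rel.of _ _ (RightSymmetricRel.right_symm a b c))

/-- The universal property: every map from the variables to a unital right-symmetric
`k`-algebra extends uniquely to a homomorphism of unital `k`-algebras. -/
theorem existsUnique_lift {k X B : Type*} [Field k] [NonAssocRing B] [Module k B]
    [IsScalarTower k B B] [SMulCommClass k B B]
    (hB : ∀ a b c : B, (a * b) * c - a * (b * c) = (a * c) * b - a * (c * b)) (g : X → B) :
    ∃! φ : FreeRightSymmetricAlgebra k X →ₙₐ[k] B, φ 1 = 1 ∧ ∀ i, φ (var k i) = g i := by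
  let c := ringConGen (RightSymmetricRel k X)
  let m : WithOne (FreeMagma X) →* B := WithOne.lift (FreeMagma.lift g)
  let F : FreeUnitalNonAssocAlgebra k X →ₙₐ[k] B := MonoidAlgebra.liftMagma k m.toMulHom
  have hsingle (w : WithOne (FreeMagma X)) : F (MonoidAlgebra.single w 1) = m w := by
    simp [F, MonoidAlgebra.liftMagma]
  have hF1 : F 1 = 1 := by
    rw [MonoidAlgebra.one_def, hsingle, map_one]
  let F' : FreeUnitalNonAssocAlgebra k X →+* B :=
    { F with
      map_one' := hF1
      map_zero' := map_zero F
      map_add' := map_add F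
      map_mul' := map_mul F }
  have hle : c ≤ RingCon.ker F' := by
    refine RingCon.ringConGen_le.2 ?_
    rintro _ _ ⟨x, y, z⟩
    change F' _ = F' _
    simp only [map_sub, map_mul]
    exact hB _ _ _
  let L := c.lift F' hle
  refine ⟨{ L with
      map_smul' := ?_
      map_zero' := map_zero L
      map_mul' := map_mul L }, ⟨map_one L, fun i => ?_⟩, ?_⟩
  · rintro r ⟨a⟩
    exact map_smul F r a
  · change F (MonoidAlgebra.single _ 1) = g i
    rw [hsingle]
    simp [m]
  · rintro ψ ⟨h1, hg⟩
    let Q : FreeUnitalNonAssocAlgebra k X →ₙₐ[k] FreeRightSymmetricAlgebra k X :=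
      { toFun := RingCon.toQuotient (c := c)
        map_smul' := fun _ _ => rfl
        map_zero' := rfl
        map_add' := fun _ _ => rfl
        map_mul' := fun _ _ => rfl }
    have key : ψ.comp Q = F := by
      refine MonoidAlgebra.nonUnitalAlgHom_ext k fun w => ?_
      rw [hsingle]
      induction w with
      | one => exact h1.trans (map_one m).symm
      | coe w =>
        induction w with
        | ih1 i => exact (hg i).trans (by simp [m])
        | ih2 u v hu hv =>
          have e : (MonoidAlgebra.single ((u * v : FreeMagma X) : WithOne (FreeMagma X)) 1 :
              FreeUnitalNonAssocAlgebra k X) =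
              MonoidAlgebra.single (u : WithOne (FreeMagma X)) 1 *
                MonoidAlgebra.single (v : WithOne (FreeMagma X)) 1 := by
            simp [MonoidAlgebra.single_mul_single]
          rw [e, map_mul, hu, hv, WithOne.coe_mul, map_mul]
    ext a
    obtain ⟨a⟩ := a
    exact NonUnitalAlgHom.congr_fun key a

end FreeRightSymmetricAlgebra

/-! Modulo smaller terms, the right-symmetric identity becomes `(ab)c = (ac)b`, so the leading
monomials of a right-symmetric algebra are rooted trees, multiplied by attaching one tree to the
root of another. A well-founded total order on trees, compatible with this product and satisfying
`R(su) < (Rs)u` (`Prec.mul_assoc`), makes this precise. It compares first the weight, the number of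
vertices labelled by variables outside the subalgebra.

Let `F` be the leading tree of `f`, which has positive weight because `f` is not in the subalgebra,
and scale `f` to be monic. A product of `f` with words has as leading tree the tree with `F` in
place of `f`. The crucial point (`IsMultiple.sub_mem`) is that two such products with the same tree
differ by smaller such products: `f` alone is a Gröbner basis of its ideal, every composition being
trivial. By `exists_leading_term`, a nonzero element of the ideal therefore has a leading tree in
which `F` occurs, so of positive weight, whereas an element of the subalgebra involves only words of
weight zero.

The two descriptions contradict each other once distinct trees are known to be linearly independent.
This comes from a model, the right-symmetric algebra of rooted trees with grafting at all vertices,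
which supplies coefficient functionals (`exists_coeff`). -/

/-! ### Rooted trees as a free magma -/

/-- The relation `(ab)c = (ac)b` on the free magma. -/
inductive NAPRel (X : Type*) : FreeMagma X → FreeMagma X → Prop
  | right_comm (a b c : FreeMagma X) : NAPRel X (a * b * c) (a * c * b)

/-- The free magma satisfying `(ab)c = (ac)b`. Its elements are the rooted trees with vertices
labelled by `X`, and `a * b` is `a` with `b` attached to the root. -/
abbrev FreeNAPMagma (X : Type*) : Type _ := (conGen (NAPRel X)).Quotient

namespace FreeNAPMagma

variable {X : Type*}

/-- The rooted tree of a nonassociative word. -/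
def mk : FreeMagma X →ₙ* FreeNAPMagma X where
  toFun w := (w : (conGen (NAPRel X)).Quotient)
  map_mul' _ _ := rfl

theorem mk_surjective (T : FreeNAPMagma X) : ∃ w, mk w = T := by
  obtain ⟨w⟩ := T
  exact ⟨w, rfl⟩

theorem mk_eq_mk {w w' : FreeMagma X} : mk w = mk w' ↔ ConGen.Rel (NAPRel X) w w' :=
  (Con.eq (conGen (NAPRel X)))

theorem right_comm (a b c : FreeNAPMagma X) : a * b * c = a * c * b := by
  obtain ⟨a, rfl⟩ := mk_surjective a
  obtain ⟨b, rfl⟩ := mk_surjective b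
  obtain ⟨c, rfl⟩ := mk_surjective c
  simp only [← map_mul]
  exact mk_eq_mk.2 (.of _ _ (.right_comm a b c))

theorem ind {P : FreeNAPMagma X → Prop} (of : ∀ x, P (mk (FreeMagma.of x)))
    (mul : ∀ a b, P a → P b → P (a * b)) (T : FreeNAPMagma X) : P T := by
  obtain ⟨w, rfl⟩ := mk_surjective T
  induction w with
  | ih1 x => exact of x
  | ih2 u v hu hv => rw [map_mul]; exact mul _ _ hu hv

/-- Fold a function and a right commutative operation over a word. -/
def foldWord {α : Type*} (g : X → α) (op : α → α → α) : FreeMagma X → α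
  | .of x => g x
  | .mul u v => op (foldWord g op u) (foldWord g op v)

/-- The universal property of the free right commutative magma. -/
def fold {α : Type*} (g : X → α) (op : α → α → α)
    (h : ∀ a b c, op (op a b) c = op (op a c) b) : FreeNAPMagma X → α :=
  Quotient.lift (foldWord g op) fun w w' hw => by
    change ConGen.Rel (NAPRel X) w w' at hw
    induction hw with
    | of _ _ hr => cases hr; exact h _ _ _
    | refl => rfl
    | symm _ ih => exact ih.symm
    | trans _ _ ih1 ih2 => exact ih1.trans ih2
    | mul _ _ ih1 ih2 => exact congrArg₂ op ih1 ih2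

@[simp] theorem fold_mul {α : Type*} (g : X → α) (op : α → α → α) (h) (a b : FreeNAPMagma X) :
    fold g op h (a * b) = op (fold g op h a) (fold g op h b) := by
  obtain ⟨a, rfl⟩ := mk_surjective a
  obtain ⟨b, rfl⟩ := mk_surjective b
  rfl

/-- The total weight of the vertices of a tree. -/
def weight (d : X → ℕ) : FreeNAPMagma X → ℕ :=
  fold d (· + ·) fun _ _ _ => by omega

@[simp] theorem weight_mul (d : X → ℕ) (a b : FreeNAPMagma X) :
    weight d (a * b) = weight d a + weight d b := fold_mul ..

/-! ### Numerical statistics of trees -/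

section Order

variable [Encodable X]

/-- The number of edges plus the sum of the codes of the labels. -/
def size : FreeNAPMagma X → ℕ :=
  fold Encodable.encode (fun a b => a + b + 1) fun _ _ _ => by omega

@[simp] theorem size_of (x : X) : size (mk (FreeMagma.of x)) = Encodable.encode x := rfl

@[simp] theorem size_mul (a b : FreeNAPMagma X) : size (a * b) = size a + size b + 1 :=
  fold_mul ..

/-- A statistic which decreases when a subtree is moved further away from the root. -/
def spread (T : FreeNAPMagma X) : ℕ :=
  (fold (fun x => ((Encodable.encode x, 0) : ℕ × ℕ))
    (fun a b => (a.1 + b.1 + 1, a.2 + b.2 + a.1 * (b.1 + 1)))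
    (fun _ _ _ => by ext <;> dsimp <;> ring) T).2

@[simp] theorem spread_mul (a b : FreeNAPMagma X) :
    spread (a * b) = spread a + spread b + size a * (size b + 1) := by
  -- `fold` sees only the values at the two factors, so the recursion carries `size` along as a
  -- first component.
  have h (T : FreeNAPMagma X) :
      (fold (fun x => ((Encodable.encode x, 0) : ℕ × ℕ))
        (fun a b => (a.1 + b.1 + 1, a.2 + b.2 + a.1 * (b.1 + 1)))
        (fun _ _ _ => by ext <;> dsimp <;> ring) T).1 = size T := by
    induction T using ind with
    | of x => rfl
    | mul a b ha hb => simp [ha, hb]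
  simp [spread, h]

/-- A numerical code for trees, injective on the trees of size less than `B`. -/
def code (B : ℕ) : FreeNAPMagma X → ℕ :=
  fold Encodable.encode (fun a b => a + B ^ (b + 1)) fun _ _ _ => by omega

@[simp] theorem code_of (B : ℕ) (x : X) :
    code B (mk (FreeMagma.of x)) = Encodable.encode x := rfl

@[simp] theorem code_mul (B : ℕ) (a b : FreeNAPMagma X) :
    code B (a * b) = code B a + B ^ (code B b + 1) := fold_mul ..

/-- The base `B` digits of `code`. -/
def digits (B : ℕ) (T : FreeNAPMagma X) : Multiset ℕ :=
  (fold (fun x => ((Encodable.encode x, Multiset.replicate (Encodable.encode x) 0) :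
      ℕ × Multiset ℕ))
    (fun a b => (a.1 + B ^ (b.1 + 1), (b.1 + 1) ::ₘ a.2))
    (fun _ _ _ => by ext : 1; dsimp; omega; exact Multiset.cons_swap _ _ _) T).2

@[simp] theorem digits_of (B : ℕ) (x : X) :
    digits B (mk (FreeMagma.of x)) = Multiset.replicate (Encodable.encode x) 0 := rfl

@[simp] theorem digits_mul (B : ℕ) (a b : FreeNAPMagma X) :
    digits B (a * b) = (code B b + 1) ::ₘ digits B a := by
  have h (T : FreeNAPMagma X) :
      (fold (fun x => ((Encodable.encode x, Multiset.replicate (Encodable.encode x) 0) :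
          ℕ × Multiset ℕ))
        (fun a b => (a.1 + B ^ (b.1 + 1), (b.1 + 1) ::ₘ a.2))
        (fun _ _ _ => by ext : 1; dsimp; omega; exact Multiset.cons_swap _ _ _) T).1
        = code B T := by
    induction T using ind with
    | of x => rfl
    | mul a b ha hb => simp [ha, hb]
  simp [digits, h]

theorem sum_digits (B : ℕ) (T : FreeNAPMagma X) :
    ((digits B T).map (B ^ ·)).sum = code B T := by
  induction T using ind with
  | of x => simp
  | mul a b ha hb => simp [ha, add_comm]

theorem card_digits_le (B : ℕ) (T : FreeNAPMagma X) : (digits B T).card ≤ size T := by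
  induction T using ind with
  | of x => simp
  | mul a b ha hb => simp; omega

/-- With fewer than `B` summands there are no carries in base `B`: powers with exponents below `a`
sum to less than `B ^ a`. Hence the sum determines the largest exponent, which is removed before
inducting. -/
theorem eq_of_sum_pow_eq {B : ℕ} (m : Multiset ℕ) : ∀ m' : Multiset ℕ, m.card < B →
    m'.card < B → (m.map (B ^ ·)).sum = (m'.map (B ^ ·)).sum → m = m' := by
  have hlt (m : Multiset ℕ) (a : ℕ) (hm : m.card < B) (h : ∀ b ∈ m, b < a) :
      (m.map (B ^ ·)).sum < B ^ a := by
    have hB : 0 < B := by omega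
    cases a with
    | zero =>
      have : m = 0 := Multiset.eq_zero_of_forall_notMem fun b hb => by simpa using h b hb
      simp [this]
    | succ a =>
      have h1 : (m.map (B ^ ·)).sum ≤ (m.map (B ^ ·)).card • B ^ a := by
        refine Multiset.sum_le_card_nsmul _ _ fun x hx => ?_
        obtain ⟨b, hb, rfl⟩ := Multiset.mem_map.1 hx
        exact Nat.pow_le_pow_right hB (Nat.lt_succ_iff.1 (h b hb))
      rw [Multiset.card_map, smul_eq_mul] at h1
      rw [pow_succ']
      exact h1.trans_lt (Nat.mul_lt_mul_of_pos_right hm (pow_pos hB a))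
  have hmax (m : Multiset ℕ) (hm : m ≠ 0) : ∃ a ∈ m, ∀ b ∈ m, b ≤ a := by
    obtain ⟨a, ha, h⟩ := m.toFinset.exists_max_image id
      (by simpa [Finset.nonempty_iff_ne_empty] using hm)
    exact ⟨a, by simpa using ha, fun b hb => h b (by simpa using hb)⟩
  have hmem (m : Multiset ℕ) (a : ℕ) (ha : a ∈ m) : B ^ a ≤ (m.map (B ^ ·)).sum :=
    Multiset.single_le_sum (by simp) _ (Multiset.mem_map_of_mem _ ha)
  induction h : m.card generalizing m with
  | zero =>
    rw [Multiset.card_eq_zero] at h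
    subst h
    intro m' h0 _ hs
    by_contra hne
    obtain ⟨a, ha⟩ := Multiset.exists_mem_of_ne_zero (Ne.symm hne)
    have := hmem m' a ha
    have hp : 0 < B ^ a := pow_pos h0 a
    simp only [Multiset.map_zero, Multiset.sum_zero] at hs
    omega
  | succ c ih =>
    intro m' h0 h1 hs
    have hm : m ≠ 0 := by rintro rfl; simp at h
    obtain ⟨a, ha, hamax⟩ := hmax m hm
    have hm' : m' ≠ 0 := by
      rintro rfl
      have := hmem m a ha
      have hp : 0 < B ^ a := pow_pos (by omega) a
      simp only [Multiset.map_zero, Multiset.sum_zero] at hs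
      omega
    obtain ⟨a', ha', hamax'⟩ := hmax m' hm'
    have haa : a = a' := by
      rcases lt_trichotomy a a' with hl | hl | hl
      · have := hlt m a' (by omega) fun b hb => (hamax b hb).trans_lt hl
        have := hmem m' a' ha'
        omega
      · exact hl
      · have := hlt m' a (by omega) fun b hb => (hamax' b hb).trans_lt hl
        have := hmem m a ha
        omega
    subst haa
    obtain ⟨t, rfl⟩ := Multiset.exists_cons_of_mem ha
    obtain ⟨t', rfl⟩ := Multiset.exists_cons_of_mem ha'
    simp only [Multiset.card_cons, Multiset.map_cons, Multiset.sum_cons] at *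
    rw [ih t (by omega) t' (by omega) (by omega) (by omega)]

/-- The shift by one in `code` keeps the exponents of branches apart from the exponent 0, which
records the root label. Right commutativity then brings the branch in question to the last position.
-/
theorem exists_mul_of_mem_digits {B a : ℕ} {T : FreeNAPMagma X} (h : a + 1 ∈ digits B T) :
    ∃ R s, T = R * s ∧ code B s = a := by
  induction T using ind with
  | of x => exact absurd (Multiset.eq_of_mem_replicate h) (by simp)
  | mul t c iht _ =>
    rw [digits_mul, Multiset.mem_cons] at h
    rcases h with h | h
    · exact ⟨t, c, rfl, by omega⟩
    · obtain ⟨R, s, rfl, hs⟩ := iht h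
      exact ⟨R * c, s, right_comm _ _ _, hs⟩

/-- The size bounds the number of digits, so the code determines the digits, and these give the root
label and the codes of the branches. Branches are smaller, so the same `B` serves throughout the
induction. -/
theorem code_injOn {B : ℕ} (T : FreeNAPMagma X) : ∀ T' : FreeNAPMagma X, size T < B →
    size T' < B → code B T = code B T' → T = T' := by
  have key (T T' : FreeNAPMagma X) (h : size T < B) (h' : size T' < B)
      (e : code B T = code B T') : digits B T = digits B T' :=
    eq_of_sum_pow_eq _ _ ((card_digits_le _ _).trans_lt h) ((card_digits_le _ _).trans_lt h')
      (by rw [sum_digits, sum_digits, e])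
  induction T using ind with
  | of x =>
    intro T' h h' e
    have hd := key _ _ h h' e
    induction T' using ind with
    | of y =>
      rw [Encodable.encode_injective (show Encodable.encode x = Encodable.encode y from e)]
    | mul a b _ _ =>
      have : code B b + 1 ∈ digits B (mk (FreeMagma.of x)) := by rw [hd]; simp
      exact absurd (Multiset.eq_of_mem_replicate this) (by simp)
  | mul t s iht ihs =>
    intro T' h h' e
    have hd := key _ _ h h' e
    have : code B s + 1 ∈ digits B T' := by rw [← hd]; simp
    obtain ⟨R, s', rfl, hs⟩ := exists_mul_of_mem_digits this
    simp only [size_mul, code_mul] at h h' e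
    obtain rfl := ihs s' (by omega) (by omega) hs.symm
    rw [iht R (by omega) (by omega) (by omega)]

end Order

/-! ### Branches and occurrences of subtrees -/

/-- The root label and the multiset of branches determine a tree. -/
noncomputable def branches (T : FreeNAPMagma X) : Multiset (FreeNAPMagma X) :=
  (fold (fun x => ((mk (FreeMagma.of x), 0) : FreeNAPMagma X × Multiset (FreeNAPMagma X)))
    (fun a b => (a.1 * b.1, b.1 ::ₘ a.2))
    (fun _ _ _ => by
      ext : 1
      · exact right_comm _ _ _
      · exact Multiset.cons_swap _ _ _) T).2

@[simp] theorem branches_of (x : X) : branches (mk (FreeMagma.of x)) = 0 := rfl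

@[simp] theorem branches_mul (a b : FreeNAPMagma X) : branches (a * b) = b ::ₘ branches a := by
  have h (T : FreeNAPMagma X) :
      (fold (fun x => ((mk (FreeMagma.of x), 0) : FreeNAPMagma X × Multiset (FreeNAPMagma X)))
        (fun a b => (a.1 * b.1, b.1 ::ₘ a.2))
        (fun _ _ _ => by
          ext : 1
          · exact right_comm _ _ _
          · exact Multiset.cons_swap _ _ _) T).1 = T := by
    induction T using ind with
    | of x => rfl
    | mul a b ha hb => rw [fold_mul, ha, hb]
  simp [branches, h]

/-- The label of the root of a tree. -/
def root : FreeNAPMagma X → X := fold id (fun a _ => a) fun _ _ _ => rfl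

@[simp] theorem root_mul (a b : FreeNAPMagma X) : root (a * b) = root a := fold_mul ..

theorem exists_mul_of_mem_branches {T s : FreeNAPMagma X} (h : s ∈ branches T) :
    ∃ R, T = R * s := by
  induction T using ind with
  | of x => simp at h
  | mul t c iht _ =>
    rw [branches_mul, Multiset.mem_cons] at h
    rcases h with rfl | h
    · exact ⟨t, rfl⟩
    · obtain ⟨R, rfl⟩ := iht h
      exact ⟨R * c, right_comm _ _ _⟩

theorem eq_of_root_eq_of_branches_eq (T : FreeNAPMagma X) : ∀ {T' : FreeNAPMagma X},
    root T = root T' → branches T = branches T' → T = T' := by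
  induction T using ind with
  | of x =>
    intro T' hr hb
    induction T' using ind with
    | of y => rw [show x = y from hr]
    | mul a b _ _ => simp at hb
  | mul t s iht ihs =>
    intro T' hr hb
    obtain ⟨R, rfl⟩ := exists_mul_of_mem_branches (T := T') (s := s) (by simp [← hb])
    simp only [root_mul, branches_mul, Multiset.cons_inj_right] at hr hb
    rw [iht hr hb]

/-- A tree is its root label with a multiset of branches, so two ways of splitting off a branch
either coincide or remove two different branches from one tree. -/
theorem mul_eq_mul {R R' s s' : FreeNAPMagma X} (h : R * s = R' * s') :
    R = R' ∧ s = s' ∨ s ≠ s' ∧ ∃ Q, R = Q * s' ∧ R' = Q * s := by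
  have hr := congrArg root h
  have hb := congrArg branches h
  simp only [root_mul, branches_mul] at hr hb
  rcases Multiset.cons_eq_cons.1 hb with ⟨rfl, -⟩ | ⟨hne, cs, h1, h2⟩
  · exact .inl ⟨eq_of_root_eq_of_branches_eq _ hr (by simpa using hb), rfl⟩
  · obtain ⟨Q, rfl⟩ := exists_mul_of_mem_branches (T := R) (s := s') (by simp [h1])
    refine .inr ⟨hne, Q, rfl, eq_of_root_eq_of_branches_eq _ (by simpa using hr.symm) ?_⟩
    simp only [branches_mul, Multiset.cons_inj_right] at h1
    rw [h2, branches_mul, h1]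

/-- `Occurs F T` says that the tree `T` has a vertex at which `F` fits. -/
inductive Occurs (F : FreeNAPMagma X) : FreeNAPMagma X → Prop
  | refl : Occurs F F
  | mul_right {T : FreeNAPMagma X} (s : FreeNAPMagma X) : Occurs F T → Occurs F (T * s)
  | mul_left {T : FreeNAPMagma X} (s : FreeNAPMagma X) : Occurs F T → Occurs F (s * T)

theorem Occurs.of_branches_le {F T : FreeNAPMagma X} (hr : root F = root T)
    (hb : branches F ≤ branches T) : Occurs F T := by
  obtain ⟨u, hu⟩ := Multiset.le_iff_exists_add.1 hb
  induction u using Multiset.induction_on generalizing T with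
  | empty => rw [eq_of_root_eq_of_branches_eq F hr (by simpa using hu.symm)]; exact .refl
  | cons a u ih =>
    obtain ⟨R, rfl⟩ := exists_mul_of_mem_branches (T := T) (s := a) (by simp [hu])
    simp only [branches_mul, Multiset.add_cons, Multiset.cons_inj_right] at hu
    exact .mul_right _ (ih (by simpa using hr) (by simp [hu]) hu)

theorem Occurs.cases_branches {F T : FreeNAPMagma X} (h : Occurs F T) :
    (root F = root T ∧ branches F ≤ branches T) ∨ ∃ R s, T = R * s ∧ Occurs F s := by
  induction h with
  | refl => exact .inl ⟨rfl, le_rfl⟩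
  | mul_right s _ ih =>
    rcases ih with ⟨hr, hb⟩ | ⟨R, s', rfl, h⟩
    · exact .inl ⟨by simpa, by simpa using hb.trans (Multiset.le_cons_self _ _)⟩
    · exact .inr ⟨R * s, s', right_comm _ _ _, h⟩
  | mul_left s h _ => exact .inr ⟨s, _, rfl, h⟩

/-- The only critical case is `F` fitting at the root of both trees. Its branches then lie in the
intersection of `s ::ₘ branches Q` and `s' ::ₘ branches Q`, which is `branches Q` since `s ≠ s'`. -/
theorem Occurs.of_mul_of_mul {F Q s s' : FreeNAPMagma X} (hne : s ≠ s') (h : Occurs F (Q * s))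
    (h' : Occurs F (Q * s')) : Occurs F Q ∨ Occurs F s ∨ Occurs F s' := by
  classical
  have aux {s : FreeNAPMagma X} (h : Occurs F (Q * s)) :
      (root F = root Q ∧ branches F ≤ s ::ₘ branches Q) ∨ Occurs F Q ∨ Occurs F s := by
    rcases h.cases_branches with ⟨hr, hb⟩ | ⟨R, c, e, hc⟩
    · exact .inl ⟨by simpa using hr, by simpa using hb⟩
    · rcases mul_eq_mul e with ⟨rfl, rfl⟩ | ⟨_, Q', rfl, rfl⟩
      · exact .inr (.inr hc)
      · exact .inr (.inl (.mul_left _ hc))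
  rcases aux h with ⟨hr, hb⟩ | h | h
  · rcases aux h' with ⟨_, hb'⟩ | h' | h'
    · refine .inl (.of_branches_le hr (Multiset.le_iff_count.2 fun a => ?_))
      have h1 := Multiset.le_iff_count.1 hb a
      have h2 := Multiset.le_iff_count.1 hb' a
      rw [Multiset.count_cons] at h1 h2
      split_ifs at h1 h2 with e1 e2
      · exact absurd (e1.symm.trans e2) hne
      all_goals omega
    · exact .inl h'
    · exact .inr (.inr h')
  · exact .inl h
  · exact .inr (.inl h)

theorem Occurs.weight_le {F T : FreeNAPMagma X} (h : Occurs F T) (d : X → ℕ) :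
    weight d F ≤ weight d T := by
  induction h with
  | refl => rfl
  | mul_right s _ ih => rw [weight_mul]; omega
  | mul_left s _ ih => rw [weight_mul]; omega

end FreeNAPMagma

/-! ### The monomial order on trees -/

namespace FreeNAPMagma

variable {X : Type*} [Encodable X]

/-- The tuple of statistics which are compared lexicographically in `Prec`. -/
def key (d : X → ℕ) (B : ℕ) (T : FreeNAPMagma X) : ℕ ×ₗ ℕ ×ₗ ℕ ×ₗ ℕ :=
  toLex (weight d T, toLex (size T, toLex (spread T, code B T)))

theorem key_lt_key {d : X → ℕ} {B : ℕ} {T T' : FreeNAPMagma X} :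
    key d B T < key d B T' ↔ weight d T < weight d T' ∨ weight d T = weight d T' ∧
      (size T < size T' ∨ size T = size T' ∧
        (spread T < spread T' ∨ spread T = spread T' ∧ code B T < code B T')) := by
  simp [key, Prod.Lex.toLex_lt_toLex]

/-- A monomial order on rooted trees which is compatible with `*`: compare weight, size, spread
and, for all large `B` with respect to an ultrafilter, the codes to the base `B`. -/
def Prec (d : X → ℕ) (T T' : FreeNAPMagma X) : Prop :=
  ∀ᶠ B in (Filter.hyperfilter ℕ : Filter ℕ), key d B T < key d B T'

namespace Prec

variable {d : X → ℕ} {R S T T' : FreeNAPMagma X}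

theorem of_lt (h : ∀ B, key d B T < key d B T') : Prec d T T' := Filter.Eventually.of_forall h

theorem trans (h : Prec d R S) (h' : Prec d S T) : Prec d R T :=
  h.mp (h'.mono fun _ h2 h1 => h1.trans h2)

theorem irrefl (T : FreeNAPMagma X) : ¬ Prec d T T := fun h => by
  obtain ⟨_, h⟩ := h.exists
  exact lt_irrefl _ h

theorem of_weight_lt (h : weight d T < weight d T') : Prec d T T' :=
  of_lt fun _ => key_lt_key.2 (.inl h)

theorem eventually_gt (m : ℕ) : ∀ᶠ B in (Filter.hyperfilter ℕ : Filter ℕ), m < B :=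
  Nat.hyperfilter_le_atTop (Filter.eventually_gt_atTop m)

/-- An ultrafilter decides every comparison, so it need not be shown that the order of the codes
stabilises as `B` grows. If neither tree precedes the other, the keys agree for some `B` exceeding
both sizes, where `code` is injective. -/
theorem trichotomy (d : X → ℕ) (T T' : FreeNAPMagma X) : Prec d T T' ∨ T = T' ∨ Prec d T' T := by
  by_cases h : Prec d T T'
  · exact .inl h
  by_cases h' : Prec d T' T
  · exact .inr (.inr h')
  refine .inr (.inl ?_)
  obtain ⟨B, h1, h2, h3, h4⟩ := ((Ultrafilter.eventually_not.2 h).and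
    ((Ultrafilter.eventually_not.2 h').and
      ((eventually_gt (size T)).and (eventually_gt (size T'))))).exists
  have e : key d B T = key d B T' := le_antisymm (not_lt.1 h2) (not_lt.1 h1)
  simp only [key, EmbeddingLike.apply_eq_iff_eq, Prod.mk.injEq] at e
  exact code_injOn _ _ h3 h4 e.2.2.2

theorem mul_right (h : Prec d T T') (s : FreeNAPMagma X) : Prec d (T * s) (T' * s) := by
  refine h.mono fun B hB => ?_
  rw [key_lt_key] at hB ⊢
  simp only [weight_mul, size_mul, spread_mul, code_mul]
  rcases hB with h | ⟨e1, h | ⟨e2, h | ⟨e3, h⟩⟩⟩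
  · exact .inl (by omega)
  · exact .inr ⟨by omega, .inl (by omega)⟩
  · exact .inr ⟨by omega, .inr ⟨by omega, .inl (by rw [e2]; omega)⟩⟩
  · exact .inr ⟨by omega, .inr ⟨by omega, .inr ⟨by rw [e2, e3], by omega⟩⟩⟩

theorem mul_left (h : Prec d T T') (s : FreeNAPMagma X) : Prec d (s * T) (s * T') := by
  refine h.mp ((eventually_gt 1).mono fun B hB1 hB => ?_)
  rw [key_lt_key] at hB ⊢
  simp only [weight_mul, size_mul, spread_mul, code_mul]
  rcases hB with h | ⟨e1, h | ⟨e2, h | ⟨e3, h⟩⟩⟩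
  · exact .inl (by omega)
  · exact .inr ⟨by omega, .inl (by omega)⟩
  · exact .inr ⟨by omega, .inr ⟨by omega, .inl (by rw [e2]; omega)⟩⟩
  · refine .inr ⟨by omega, .inr ⟨by omega, .inr ⟨by rw [e2, e3], ?_⟩⟩⟩
    have := Nat.pow_lt_pow_right hB1 (Nat.succ_lt_succ h)
    simpa using this

theorem left_mul (T s : FreeNAPMagma X) : Prec d T (T * s) :=
  of_lt fun _ => key_lt_key.2 (by simp only [weight_mul, size_mul]; omega)

theorem right_mul (T s : FreeNAPMagma X) : Prec d T (s * T) :=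
  of_lt fun _ => key_lt_key.2 (by simp only [weight_mul, size_mul]; omega)

/-- Weight and size agree, and the spreads differ by `size u + 1`. This is why the terms `a(bc)` and
`a(cb)` of the right-symmetric identity are of lower order. -/
theorem mul_assoc (R s u : FreeNAPMagma X) : Prec d (R * (s * u)) (R * s * u) :=
  of_lt fun _ => key_lt_key.2 <| .inr ⟨by simp only [weight_mul]; omega,
    .inr ⟨by simp only [size_mul]; omega, .inl (by simp only [spread_mul, size_mul]; nlinarith)⟩⟩

/-- Because `size` includes the codes of the labels, this holds even for infinite `X`. -/
theorem finite_setOf_size_le (m : ℕ) : {T : FreeNAPMagma X | size T ≤ m}.Finite := by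
  induction m using Nat.strong_induction_on with
  | _ m ih =>
    have hX : {x : X | Encodable.encode x ≤ m}.Finite :=
      (Set.finite_Iic m).preimage Encodable.encode_injective.injOn
    have h : {T : FreeNAPMagma X | size T < m}.Finite := by
      cases m with
      | zero => simp
      | succ m => simpa [Nat.lt_succ_iff] using ih m (by omega)
    refine ((hX.image fun x => mk (FreeMagma.of x)).union (h.image2 (· * ·) h)).subset ?_
    intro T hT
    induction T using ind with
    | of x => exact .inl ⟨x, hT, rfl⟩
    | mul a b _ _ =>
      rw [Set.mem_ofPred_eq, size_mul] at hT
      exact .inr ⟨a, show size a < m by omega, b, show size b < m by omega, rfl⟩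

/-- No single `B` computes the order, so `key` itself is not a rank. Since only finitely many trees
share a size, the number of predecessors of the same size serves as the last component of a rank. -/
theorem wellFounded (d : X → ℕ) : WellFounded (Prec d) := by
  let below (T : FreeNAPMagma X) : Set (FreeNAPMagma X) := {S | size S = size T ∧ Prec d S T}
  have hfin (T) : (below T).Finite :=
    (finite_setOf_size_le (size T)).subset fun S hS => hS.1.le
  let r (T : FreeNAPMagma X) : ℕ ×ₗ ℕ ×ₗ ℕ :=
    toLex (weight d T, toLex (size T, (below T).ncard))
  refine Subrelation.wf (r := InvImage (· < ·) r) (fun {S T} h => ?_) (InvImage.wf r wellFounded_lt)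
  change r S < r T
  obtain ⟨B, hB⟩ := h.exists
  rw [key_lt_key] at hB
  simp only [r, Prod.Lex.toLex_lt_toLex]
  rcases hB with hB | ⟨e1, hB | ⟨e2, -⟩⟩
  · exact .inl hB
  · exact .inr ⟨e1, .inl hB⟩
  · refine .inr ⟨e1, .inr ⟨e2, Set.ncard_lt_ncard ?_ (hfin T)⟩⟩
    refine ⟨fun U hU => ⟨hU.1.trans e2, hU.2.trans h⟩, fun hsub => ?_⟩
    exact irrefl _ (hsub (show S ∈ below T from ⟨e2, h⟩)).2

end Prec

theorem Occurs.eq_or_prec {F T : FreeNAPMagma X} (h : Occurs F T) (d : X → ℕ) :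
    F = T ∨ Prec d F T := by
  induction h with
  | refl => exact .inl rfl
  | mul_right s _ ih =>
    rcases ih with rfl | h
    · exact .inr (.left_mul _ _)
    · exact .inr (h.trans (.left_mul _ _))
  | mul_left s _ ih =>
    rcases ih with rfl | h
    · exact .inr (.right_mul _ _)
    · exact .inr (h.trans (.right_mul _ _))

end FreeNAPMagma

open FreeNAPMagma

/-! ### Leading terms in a span -/

section LeadingTerms

variable {k A X : Type*} [Field k] [AddCommGroup A] [Module k A] [Encodable X]

/-- The span of `K` and of all `h` that are marked by `E` with a tree smaller than `T`. -/
def belowSpan (k : Type*) {A X : Type*} [Field k] [AddCommGroup A] [Module k A] [Encodable X]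
    (d : X → ℕ) (K : Set A) (E : A → FreeNAPMagma X → Prop) (T : FreeNAPMagma X) :
    Submodule k A :=
  Submodule.span k (K ∪ {h | ∃ S, E h S ∧ Prec d S T})

variable {d : X → ℕ} {K : Set A} {E : A → FreeNAPMagma X → Prop} {S T : FreeNAPMagma X}

theorem belowSpan_mono (h : Prec d S T) : belowSpan k d K E S ≤ belowSpan k d K E T :=
  Submodule.span_mono <| Set.union_subset_union_right _ fun _ ⟨U, hU, hlt⟩ => ⟨U, hU, hlt.trans h⟩

theorem mem_belowSpan {a : A} (h : E a S) (hlt : Prec d S T) : a ∈ belowSpan k d K E T :=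
  Submodule.subset_span (.inr ⟨S, h, hlt⟩)

theorem span_le_belowSpan : Submodule.span k K ≤ belowSpan k d K E T :=
  Submodule.span_mono Set.subset_union_left

theorem belowSpan_le {N : Submodule k A} (hK : K ⊆ N)
    (hE : ∀ a S, E a S → Prec d S T → a ∈ N) : belowSpan k d K E T ≤ N :=
  Submodule.span_le.2 <| Set.union_subset hK fun a ⟨S, ha, hlt⟩ => hE a S ha hlt

theorem exists_mem_belowSpan (T₀ : FreeNAPMagma X) {a : A}
    (ha : a ∈ Submodule.span k (K ∪ {h | ∃ S, E h S})) : ∃ T, a ∈ belowSpan k d K E T := by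
  induction ha using Submodule.span_induction with
  | mem x hx =>
    rcases hx with hx | ⟨S, hS⟩
    · exact ⟨T₀, Submodule.subset_span (.inl hx)⟩
    -- `S * S` is merely some tree above `S`.
    · exact ⟨S * S, mem_belowSpan hS (.left_mul _ _)⟩
  | zero => exact ⟨T₀, zero_mem _⟩
  | add x y _ _ hx hy =>
    obtain ⟨S, hx⟩ := hx
    obtain ⟨T, hy⟩ := hy
    exact ⟨S * T, add_mem (belowSpan_mono (.left_mul _ _) hx) (belowSpan_mono (.right_mul _ _) hy)⟩
  | smul r x _ hx =>
    obtain ⟨S, hx⟩ := hx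
    exact ⟨S, Submodule.smul_mem _ _ hx⟩

/-- If elements marked with the same tree agree up to smaller terms, then every element of the span
has a leading term. -/
theorem exists_leading_term
    (hE : ∀ T h h', E h T → E h' T → h - h' ∈ belowSpan k d K E T) (T : FreeNAPMagma X) :
    ∀ {a : A}, a ∈ belowSpan k d K E T → a ∈ Submodule.span k K ∨ ∃ c : k, c ≠ 0 ∧ ∃ h S,
      E h S ∧ Prec d S T ∧ a - c • h ∈ belowSpan k d K E S := by
  induction T using (Prec.wellFounded d).induction with
  | _ T ih =>
  intro a ha
  induction ha using Submodule.span_induction with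
  | mem x hx =>
    rcases hx with hx | ⟨S, hS, hlt⟩
    · exact .inl (Submodule.subset_span hx)
    · exact .inr ⟨1, one_ne_zero, x, S, hS, hlt, by simp⟩
  | zero => exact .inl (zero_mem _)
  | add x y _ _ hx hy =>
    rcases hx with hx | ⟨c, hc, h, S, hS, hlt, hx⟩
    · rcases hy with hy | ⟨c', hc', h', S', hS', hlt', hy⟩
      · exact .inl (add_mem hx hy)
      · refine .inr ⟨c', hc', h', S', hS', hlt', ?_⟩
        rw [add_sub_assoc]
        exact add_mem (span_le_belowSpan hx) hy
    rcases hy with hy | ⟨c', hc', h', S', hS', hlt', hy⟩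
    · refine .inr ⟨c, hc, h, S, hS, hlt, ?_⟩
      rw [add_sub_right_comm]
      exact add_mem hx (span_le_belowSpan hy)
    rcases Prec.trichotomy d S S' with hSS | rfl | hSS
    · refine .inr ⟨c', hc', h', S', hS', hlt', ?_⟩
      rw [add_sub_assoc]
      refine add_mem ?_ hy
      rw [← sub_add_cancel x (c • h)]
      exact add_mem (belowSpan_mono hSS hx) (Submodule.smul_mem _ _ (mem_belowSpan hS hSS))
    · have e : x + y - (c + c') • h ∈ belowSpan k d K E S := by
        have : x + y - (c + c') • h = (x - c • h) + (y - c' • h') + c' • (h' - h) := by module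
        rw [this]
        exact add_mem (add_mem hx hy) (Submodule.smul_mem _ _ (hE _ _ _ hS' hS))
      by_cases h0 : c + c' = 0
      · rw [h0, zero_smul, sub_zero] at e
        rcases ih S hlt e with h1 | ⟨c, hc, h, U, hU, hlt', hx⟩
        · exact .inl h1
        · exact .inr ⟨c, hc, h, U, hU, hlt'.trans hlt, hx⟩
      · exact .inr ⟨_, h0, h, S, hS, hlt, e⟩
    · refine .inr ⟨c, hc, h, S, hS, hlt, ?_⟩
      rw [add_sub_right_comm]
      refine add_mem hx ?_
      rw [← sub_add_cancel y (c' • h')]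
      exact add_mem (belowSpan_mono hSS hy) (Submodule.smul_mem _ _ (mem_belowSpan hS' hSS))
  | smul r x _ hx =>
    by_cases hr : r = 0
    · exact .inl (by simp [hr])
    rcases hx with hx | ⟨c, hc, h, S, hS, hlt, hx⟩
    · exact .inl (Submodule.smul_mem _ _ hx)
    · refine .inr ⟨r * c, mul_ne_zero hr hc, h, S, hS, hlt, ?_⟩
      rw [mul_smul, ← smul_sub]
      exact Submodule.smul_mem _ _ hx

end LeadingTerms

/-! ### Words and multiples of `f` in a right-symmetric algebra -/

section RightSymmetric

variable {k A X : Type*} [Field k] [NonAssocRing A] [Module k A] {g : X → A} {f : A}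
  {F : FreeNAPMagma X}

/-- `a` is the value of a word whose tree is `S`. -/
def IsWord (g : X → A) (a : A) (S : FreeNAPMagma X) : Prop :=
  ∃ w, FreeMagma.lift g w = a ∧ mk w = S

theorem IsWord.mul {a b : A} {S T : FreeNAPMagma X} (ha : IsWord g a S) (hb : IsWord g b T) :
    IsWord g (a * b) (S * T) := by
  obtain ⟨w, rfl, rfl⟩ := ha
  obtain ⟨w', rfl, rfl⟩ := hb
  exact ⟨w * w', map_mul _ _ _, map_mul _ _ _⟩

theorem exists_isWord (g : X → A) (T : FreeNAPMagma X) : ∃ a, IsWord g a T := by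
  obtain ⟨w, rfl⟩ := mk_surjective T
  exact ⟨_, w, rfl, rfl⟩

/-- The products of `f` with words, marked with the trees obtained by replacing `f` by `F`. -/
inductive IsMultiple (g : X → A) (f : A) (F : FreeNAPMagma X) : A → FreeNAPMagma X → Prop
  | refl : IsMultiple g f F f F
  | mul_right {h b : A} {T S : FreeNAPMagma X} : IsMultiple g f F h T → IsWord g b S →
      IsMultiple g f F (h * b) (T * S)
  | mul_left {h b : A} {T S : FreeNAPMagma X} : IsMultiple g f F h T → IsWord g b S →
      IsMultiple g f F (b * h) (S * T)

theorem IsMultiple.occurs {h : A} {T : FreeNAPMagma X} (hh : IsMultiple g f F h T) :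
    Occurs F T := by
  induction hh with
  | refl => exact .refl
  | mul_right _ _ ih => exact .mul_right _ ih
  | mul_left _ _ ih => exact .mul_left _ ih

theorem FreeNAPMagma.Occurs.exists_isMultiple {T : FreeNAPMagma X} (hT : Occurs F T) (g : X → A)
    (f : A) : ∃ h, IsMultiple g f F h T := by
  induction hT with
  | refl => exact ⟨f, .refl⟩
  | mul_right s _ ih =>
    obtain ⟨h, ih⟩ := ih
    obtain ⟨b, hb⟩ := exists_isWord g s
    exact ⟨_, ih.mul_right hb⟩
  | mul_left s _ ih =>
    obtain ⟨h, ih⟩ := ih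
    obtain ⟨b, hb⟩ := exists_isWord g s
    exact ⟨_, ih.mul_left hb⟩

/-- `h` is a product of two factors with trees `R` and `S`, one a word and the other a multiple
of `f`. -/
def IsProduct (g : X → A) (f : A) (F : FreeNAPMagma X) (h : A) (R S : FreeNAPMagma X) : Prop :=
  (∃ a b, IsMultiple g f F a R ∧ IsWord g b S ∧ h = a * b) ∨
    ∃ a b, IsWord g a R ∧ IsMultiple g f F b S ∧ h = a * b

theorem IsMultiple.cases_product {h : A} {T : FreeNAPMagma X} (hh : IsMultiple g f F h T) :
    (h = f ∧ T = F) ∨ ∃ R S, T = R * S ∧ IsProduct g f F h R S := by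
  cases hh with
  | refl => exact .inl ⟨rfl, rfl⟩
  | mul_right h1 h2 => exact .inr ⟨_, _, rfl, .inl ⟨_, _, h1, h2, rfl⟩⟩
  | mul_left h1 h2 => exact .inr ⟨_, _, rfl, .inr ⟨_, _, h2, h1, rfl⟩⟩

theorem IsProduct.occurs {h : A} {R S : FreeNAPMagma X} (hh : IsProduct g f F h R S) :
    Occurs F R ∨ Occurs F S := by
  rcases hh with ⟨_, _, h, _⟩ | ⟨_, _, _, h, _⟩
  · exact .inl h.occurs
  · exact .inr h.occurs

variable [Encodable X] {d : X → ℕ}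

/-- The span of `1` and of the values of the words with trees smaller than `T`. -/
abbrev wordsBelow (k : Type*) {A X : Type*} [Field k] [NonAssocRing A] [Module k A] [Encodable X]
    (d : X → ℕ) (g : X → A) (T : FreeNAPMagma X) : Submodule k A :=
  belowSpan k d {1} (IsWord g) T

/-- The span of the multiples of `f` marked with trees smaller than `T`. -/
abbrev multiplesBelow (k : Type*) {A X : Type*} [Field k] [NonAssocRing A] [Module k A]
    [Encodable X] (d : X → ℕ) (g : X → A) (f : A) (F T : FreeNAPMagma X) : Submodule k A :=
  belowSpan k d ∅ (IsMultiple g f F) T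

/-- If `F` occurs in `Q` or in `s`, then some products of `f` along the two decompositions of
`(Q * s') * s = (Q * s) * s'` agree up to smaller multiples of `f`. -/
theorem exists_isProduct_sub_mem
    (hA : ∀ a b c : A, (a * b) * c - a * (b * c) = (a * c) * b - a * (c * b))
    {Q s s' : FreeNAPMagma X} (hF : Occurs F Q ∨ Occurs F s) :
    ∃ h h', IsProduct g f F h (Q * s') s ∧ IsProduct g f F h' (Q * s) s' ∧
      h - h' ∈ multiplesBelow k d g f F (Q * s' * s) := by
  have e (a b c : A) : (a * b) * c - (a * c) * b = a * (b * c) - a * (c * b) := by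
    have := hA a b c
    rw [sub_eq_sub_iff_add_eq_add] at this ⊢
    rw [this, add_comm]
  -- `f` is placed inside a factor where `F` occurs, and the other two factors are arbitrary words.
  -- The identity `e` then leaves two multiples that are smaller by `Prec.mul_assoc`.
  obtain ⟨c, hc⟩ := exists_isWord g s'
  rcases hF with hF | hF
  · obtain ⟨h, hh⟩ := hF.exists_isMultiple g f
    obtain ⟨b, hb⟩ := exists_isWord g s
    refine ⟨h * c * b, h * b * c, .inl ⟨_, _, hh.mul_right hc, hb, rfl⟩,
      .inl ⟨_, _, hh.mul_right hb, hc, rfl⟩, ?_⟩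
    rw [e]
    refine _root_.sub_mem (mem_belowSpan (hh.mul_right (hc.mul hb)) (.mul_assoc _ _ _))
      (mem_belowSpan (hh.mul_right (hb.mul hc)) ?_)
    rw [right_comm]
    exact .mul_assoc _ _ _
  · obtain ⟨h, hh⟩ := hF.exists_isMultiple g f
    obtain ⟨q, hq⟩ := exists_isWord g Q
    refine ⟨q * c * h, q * h * c, .inr ⟨_, _, hq.mul hc, hh, rfl⟩,
      .inl ⟨_, _, hh.mul_left hq, hc, rfl⟩, ?_⟩
    rw [e]
    refine _root_.sub_mem (mem_belowSpan ((hh.mul_left hc).mul_left hq) (.mul_assoc _ _ _))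
      (mem_belowSpan ((hh.mul_right hc).mul_left hq) ?_)
    rw [right_comm]
    exact .mul_assoc _ _ _

theorem mul_mem_of_belowSpan [IsScalarTower k A A] {K : Set A} {E : A → FreeNAPMagma X → Prop} {T : FreeNAPMagma X}
    {N : Submodule k A} {a b : A} (ha : a ∈ belowSpan k d K E T) (hK : ∀ x ∈ K, x * b ∈ N)
    (hE : ∀ h S, E h S → Prec d S T → h * b ∈ N) : a * b ∈ N := by
  have h : belowSpan k d K E T ≤ N.comap (LinearMap.mulRight k b) :=
    belowSpan_le (fun x hx => hK x hx) fun h S hS hlt => hE h S hS hlt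
  exact h ha

theorem mul_mem_of_belowSpan' [SMulCommClass k A A] {K : Set A} {E : A → FreeNAPMagma X → Prop} {T : FreeNAPMagma X}
    {N : Submodule k A} {a b : A} (ha : a ∈ belowSpan k d K E T) (hK : ∀ x ∈ K, b * x ∈ N)
    (hE : ∀ h S, E h S → Prec d S T → b * h ∈ N) : b * a ∈ N := by
  have h : belowSpan k d K E T ≤ N.comap (LinearMap.mulLeft k b) :=
    belowSpan_le (fun x hx => hK x hx) fun h S hS hlt => hE h S hS hlt
  exact h ha

theorem wordsBelow_mul [IsScalarTower k A A]
    {a b : A} {S T : FreeNAPMagma X} (ha : a ∈ wordsBelow k d g S)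
    (hb : IsWord g b T) : a * b ∈ wordsBelow k d g (S * T) := by
  refine mul_mem_of_belowSpan ha ?_ fun h U hU hlt => mem_belowSpan (hU.mul hb) (hlt.mul_right _)
  rintro _ rfl
  rw [one_mul]
  exact mem_belowSpan hb (.right_mul _ _)

theorem mul_wordsBelow [SMulCommClass k A A]
    {a b : A} {S T : FreeNAPMagma X} (ha : a ∈ wordsBelow k d g S)
    (hb : IsWord g b T) : b * a ∈ wordsBelow k d g (T * S) := by
  refine mul_mem_of_belowSpan' ha ?_ fun h U hU hlt => mem_belowSpan (hb.mul hU) (hlt.mul_left _)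
  rintro _ rfl
  rw [mul_one]
  exact mem_belowSpan hb (.left_mul _ _)

theorem multiplesBelow_mul [IsScalarTower k A A]
    {a b : A} {S T : FreeNAPMagma X}
    (ha : a ∈ multiplesBelow k d g f F S) (hb : IsWord g b T) :
    a * b ∈ multiplesBelow k d g f F (S * T) :=
  mul_mem_of_belowSpan ha (by simp) fun _ _ hU hlt => mem_belowSpan (hU.mul_right hb)
    (hlt.mul_right _)

theorem mul_multiplesBelow [SMulCommClass k A A]
    {a b : A} {S T : FreeNAPMagma X}
    (ha : a ∈ multiplesBelow k d g f F S) (hb : IsWord g b T) :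
    b * a ∈ multiplesBelow k d g f F (T * S) :=
  mul_mem_of_belowSpan' ha (by simp) fun _ _ hU hlt => mem_belowSpan (hU.mul_left hb)
    (hlt.mul_left _)

theorem IsMultiple.mul_wordsBelow [SMulCommClass k A A]
    {a h : A} {S T : FreeNAPMagma X} (hh : IsMultiple g f F h T)
    (ha : a ∈ wordsBelow k d g S) : h * a ∈ multiplesBelow k d g f F (T * S) := by
  refine mul_mem_of_belowSpan' ha ?_ fun _ _ hU hlt => mem_belowSpan (hh.mul_right hU)
    (hlt.mul_left _)
  rintro _ rfl
  rw [mul_one]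
  exact mem_belowSpan hh (.left_mul _ _)

theorem IsMultiple.wordsBelow_mul [IsScalarTower k A A]
    {a h : A} {S T : FreeNAPMagma X} (hh : IsMultiple g f F h T)
    (ha : a ∈ wordsBelow k d g S) : a * h ∈ multiplesBelow k d g f F (S * T) := by
  refine mul_mem_of_belowSpan ha ?_ fun _ _ hU hlt => mem_belowSpan (hh.mul_left hU)
    (hlt.mul_right _)
  rintro _ rfl
  rw [one_mul]
  exact mem_belowSpan hh (.right_mul _ _)

variable [IsScalarTower k A A] [SMulCommClass k A A]

/-- In a right-symmetric algebra, words with the same tree agree up to smaller words. -/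
theorem IsWord.sub_mem (hA : ∀ a b c : A, (a * b) * c - a * (b * c) = (a * c) * b - a * (c * b))
    (T : FreeNAPMagma X) (a b : A) (ha : IsWord g a T) (hb : IsWord g b T) :
    a - b ∈ wordsBelow k d g T := by
  obtain ⟨w, rfl, rfl⟩ := ha
  obtain ⟨w', rfl, h⟩ := hb
  have hr := mk_eq_mk.1 h.symm
  clear h
  induction hr with
  | of _ _ h =>
    obtain ⟨u, v, w⟩ := h
    simp only [map_mul]
    have e := hA (FreeMagma.lift g u) (FreeMagma.lift g v) (FreeMagma.lift g w)
    rw [sub_eq_iff_eq_add, sub_add_eq_add_sub, add_sub_assoc] at e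
    rw [e, add_sub_cancel_left]
    refine _root_.sub_mem (mem_belowSpan ⟨u * (v * w), by simp, rfl⟩ ?_)
      (mem_belowSpan ⟨u * (w * v), by simp, rfl⟩ ?_)
    · rw [map_mul, map_mul]
      exact .mul_assoc _ _ _
    · rw [right_comm, map_mul, map_mul]
      exact .mul_assoc _ _ _
  | refl => simp
  | symm h ih =>
    rw [← neg_sub, neg_mem_iff, mk_eq_mk.2 h.symm]
    exact ih
  | trans h1 h2 ih1 ih2 =>
    rw [← sub_add_sub_cancel]
    refine add_mem ih1 ?_
    rw [mk_eq_mk.2 h1]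
    exact ih2
  | @mul u u' v v' h1 h2 ih1 ih2 =>
    have e : FreeMagma.lift g (u * v) - FreeMagma.lift g (u' * v') =
        (FreeMagma.lift g u - FreeMagma.lift g u') * FreeMagma.lift g v +
        FreeMagma.lift g u' * (FreeMagma.lift g v - FreeMagma.lift g v') := by
      simp only [map_mul, sub_mul, mul_sub]
      abel
    rw [e, map_mul]
    refine add_mem (wordsBelow_mul ih1 ⟨_, rfl, rfl⟩)
      (mul_wordsBelow ih2 ⟨_, rfl, mk_eq_mk.2 h1.symm⟩)

/-- The hypothesis `hf` says that `f` is monic with leading tree `F`. Multiplication by words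
respects the order, so leading trees multiply. -/
theorem IsMultiple.sub_mem_wordsBelow
    (hA : ∀ a b c : A, (a * b) * c - a * (b * c) = (a * c) * b - a * (c * b))
    (hf : ∀ b, IsWord g b F → f - b ∈ wordsBelow k d g F)
    {h : A} {T : FreeNAPMagma X} (hh : IsMultiple g f F h T) :
    ∀ b, IsWord g b T → h - b ∈ wordsBelow k d g T := by
  induction hh with
  | refl => exact hf
  | @mul_right h c T S hh hc ih =>
    intro b hb
    obtain ⟨a, ha⟩ := exists_isWord g T
    have e : h * c - b = (h - a) * c + (a * c - b) := by rw [sub_mul]; abel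
    rw [e]
    exact add_mem (_root_.wordsBelow_mul (ih a ha) hc) (IsWord.sub_mem hA _ _ _ (ha.mul hc) hb)
  | @mul_left h c T S hh hc ih =>
    intro b hb
    obtain ⟨a, ha⟩ := exists_isWord g T
    have e : c * h - b = c * (h - a) + (c * a - b) := by rw [mul_sub]; abel
    rw [e]
    exact add_mem (_root_.mul_wordsBelow (ih a ha) hc) (IsWord.sub_mem hA _ _ _ (hc.mul ha) hb)

/-- The factors are exchanged one at a time. If `f` sits in different factors of `h` and `h'`, the
intermediate product has multiples of `f` in both factors, and each exchange replaces one multiple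
by a word up to smaller words. -/
theorem IsProduct.sub_mem
    (hA : ∀ a b c : A, (a * b) * c - a * (b * c) = (a * c) * b - a * (c * b))
    (hf : ∀ b, IsWord g b F → f - b ∈ wordsBelow k d g F) {R S : FreeNAPMagma X}
    (hR : ∀ h h', IsMultiple g f F h R → IsMultiple g f F h' R →
      h - h' ∈ multiplesBelow k d g f F R)
    (hS : ∀ h h', IsMultiple g f F h S → IsMultiple g f F h' S →
      h - h' ∈ multiplesBelow k d g f F S)
    {h h' : A} (hh : IsProduct g f F h R S) (hh' : IsProduct g f F h' R S) :
    h - h' ∈ multiplesBelow k d g f F (R * S) := by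
  have e (a b a' b' : A) : a * b - a' * b' = (a - a') * b + a' * (b - b') := by
    rw [sub_mul, mul_sub]; abel
  have e' (a b a' b' : A) : a * b - a' * b' = (a - a') * b' + a * (b - b') := by
    rw [sub_mul, mul_sub]; abel
  rcases hh with ⟨a, b, ha, hb, rfl⟩ | ⟨a, b, ha, hb, rfl⟩ <;>
    rcases hh' with ⟨a', b', ha', hb', rfl⟩ | ⟨a', b', ha', hb', rfl⟩
  · rw [e]
    exact add_mem (multiplesBelow_mul (hR _ _ ha ha') hb)
      (ha'.mul_wordsBelow (IsWord.sub_mem hA _ _ _ hb hb'))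
  · rw [e']
    refine add_mem (hb'.wordsBelow_mul (ha.sub_mem_wordsBelow hA hf _ ha')) (ha.mul_wordsBelow ?_)
    rw [← neg_sub, neg_mem_iff]
    exact hb'.sub_mem_wordsBelow hA hf _ hb
  · rw [e]
    refine add_mem (hb.wordsBelow_mul ?_) (ha'.mul_wordsBelow (hb.sub_mem_wordsBelow hA hf _ hb'))
    rw [← neg_sub, neg_mem_iff]
    exact ha'.sub_mem_wordsBelow hA hf _ ha
  · rw [e]
    exact add_mem (hb.wordsBelow_mul (IsWord.sub_mem hA _ _ _ ha ha'))
      (mul_multiplesBelow (hS _ _ hb hb') ha')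

/-- Multiples of `f` with the same tree agree up to smaller multiples. -/
theorem IsMultiple.sub_mem
    (hA : ∀ a b c : A, (a * b) * c - a * (b * c) = (a * c) * b - a * (c * b))
    (hf : ∀ b, IsWord g b F → f - b ∈ wordsBelow k d g F) (T : FreeNAPMagma X) :
    ∀ h h' : A, IsMultiple g f F h T → IsMultiple g f F h' T →
      h - h' ∈ multiplesBelow k d g f F T := by
  induction T using (Prec.wellFounded d).induction with
  | _ T ih =>
  -- A proper product containing `f` has a tree strictly above `F`, so only `f` itself is marked
  -- with `F`.
  have not_prec {h : A} (hh : IsMultiple g f F h T) (hT : T = F) : h = f := by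
    rcases hh.cases_product with ⟨e, -⟩ | ⟨R, S, rfl, hp⟩
    · exact e
    · exfalso
      have h1 : Prec d F (R * S) := by
        rcases hp.occurs with ho | ho <;> rcases ho.eq_or_prec d with rfl | hlt
        · exact .left_mul _ _
        · exact hlt.trans (.left_mul _ _)
        · exact .right_mul _ _
        · exact hlt.trans (.right_mul _ _)
      rw [hT] at h1
      exact Prec.irrefl _ h1
  intro h h' hh hh'
  by_cases hT : T = F
  · rw [not_prec hh hT, not_prec hh' hT, sub_self]
    exact zero_mem _
  obtain ⟨-, e⟩ | ⟨R, s, rfl, hp⟩ := hh.cases_product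
  · exact absurd e hT
  obtain ⟨-, e⟩ | ⟨R', s', e, hp'⟩ := hh'.cases_product
  · exact absurd e hT
  rcases mul_eq_mul e with ⟨rfl, rfl⟩ | ⟨hne, Q, rfl, rfl⟩
  · exact IsProduct.sub_mem hA hf (ih _ (.left_mul _ _)) (ih _ (.right_mul _ _)) hp hp'
  -- The path from `h` to `h'` stays within one decomposition up to `x`, crosses to the other at
  -- `x'`, and stays within that one.
  have connect {x x' : A} (hx : IsProduct g f F x (Q * s') s) (hx' : IsProduct g f F x' (Q * s) s')
      (hxx : x - x' ∈ multiplesBelow k d g f F (Q * s' * s)) :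
      h - h' ∈ multiplesBelow k d g f F (Q * s' * s) := by
    have h1 := IsProduct.sub_mem hA hf (ih _ (.left_mul _ _)) (ih _ (.right_mul _ _)) hp hx
    have h2 : x' - h' ∈ multiplesBelow k d g f F (Q * s * s') :=
      IsProduct.sub_mem hA hf (ih _ (by rw [right_comm]; exact .left_mul _ _))
        (ih _ (by rw [right_comm]; exact .right_mul _ _)) hx' hp'
    rw [right_comm] at h2
    have := add_mem (add_mem h1 hxx) h2
    rwa [sub_add_sub_cancel, sub_add_sub_cancel] at this
  have hF : Occurs F Q ∨ Occurs F s ∨ Occurs F s' := by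
    rcases hp.occurs with h1 | h1
    · rcases hp'.occurs with h2 | h2
      · exact (Occurs.of_mul_of_mul hne.symm h1 h2).imp_right Or.symm
      · exact .inr (.inr h2)
    · exact .inr (.inl h1)
  -- If `F` occurs only in `s'`, the roles of `s` and `s'` are interchanged.
  by_cases hF' : Occurs F Q ∨ Occurs F s
  · obtain ⟨x, x', hx, hx', hxx⟩ := exists_isProduct_sub_mem (k := k) (d := d) (g := g) (f := f)
      (s' := s') hA hF'
    exact connect hx hx' hxx
  · obtain ⟨x', x, hx', hx, hxx⟩ := exists_isProduct_sub_mem (k := k) (d := d) (g := g) (f := f)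
      (Q := Q) (s := s') (s' := s) hA (.inr (by tauto))
    refine connect hx hx' ?_
    rw [right_comm, ← neg_sub, neg_mem_iff]
    exact hxx

end RightSymmetric

/-! ### The right-symmetric algebra of rooted trees -/

/-- The algebra of rooted trees, with the product `a * b` equal to the sum over all vertices of `a`
of the trees obtained by attaching `b` to that vertex. -/
def TreeAlgebra (k X : Type*) [Field k] : Type _ := FreeNAPMagma X →₀ k

namespace TreeAlgebra

variable {k X : Type*} [Field k]

noncomputable instance : AddCommGroup (TreeAlgebra k X) :=
  inferInstanceAs (AddCommGroup (FreeNAPMagma X →₀ k))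

noncomputable instance : Module k (TreeAlgebra k X) :=
  inferInstanceAs (Module k (FreeNAPMagma X →₀ k))

/-- The basis of trees. -/
noncomputable def tree (k : Type*) {X : Type*} [Field k] (T : FreeNAPMagma X) : TreeAlgebra k X :=
  Finsupp.single T (1 : k)

/-- The coefficient of a tree. -/
noncomputable def coeff (T : FreeNAPMagma X) : TreeAlgebra k X →ₗ[k] k := Finsupp.lapply T

@[simp] theorem coeff_tree_self (T : FreeNAPMagma X) : coeff T (tree k T) = 1 :=
  Finsupp.single_eq_same

theorem coeff_tree_of_ne {S T : FreeNAPMagma X} (h : S ≠ T) : coeff T (tree k S) = 0 :=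
  Finsupp.single_eq_of_ne h.symm

/-- Extend a function on trees linearly. -/
noncomputable def extend {M : Type*} [AddCommGroup M] [Module k M] (φ : FreeNAPMagma X → M) :
    TreeAlgebra k X →ₗ[k] M := Finsupp.linearCombination k φ

@[simp] theorem extend_tree {M : Type*} [AddCommGroup M] [Module k M] (φ : FreeNAPMagma X → M)
    (T : FreeNAPMagma X) : extend φ (tree k T) = φ T :=
  (Finsupp.linearCombination_single k 1 T).trans (one_smul _ _)

theorem hom_ext {M : Type*} [AddCommGroup M] [Module k M] {φ ψ : TreeAlgebra k X →ₗ[k] M}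
    (h : ∀ T, φ (tree k T) = ψ (tree k T)) : φ = ψ :=
  Finsupp.lhom_ext' fun T => LinearMap.ext_ring (h T)

/-- The bilinear product attaching one tree to the root of another. -/
noncomputable def attach : TreeAlgebra k X →ₗ[k] TreeAlgebra k X →ₗ[k] TreeAlgebra k X :=
  extend fun T => extend fun S => tree k (T * S)

@[simp] theorem attach_tree (T S : FreeNAPMagma X) :
    attach (tree k T) (tree k S) = tree k (T * S) := by
  simp [attach]

theorem attach_right_comm (a b c : TreeAlgebra k X) :
    attach (attach a b) c = attach (attach a c) b := by
  let φ : TreeAlgebra k X →ₗ[k] TreeAlgebra k X →ₗ[k] TreeAlgebra k X →ₗ[k] TreeAlgebra k X :=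
    (LinearMap.llcomp k _ _ _ attach) ∘ₗ attach
  let ψ := (LinearMap.lflip (R₀ := k)).toLinearMap ∘ₗ φ
  have h : φ = ψ := hom_ext fun T => hom_ext fun S => hom_ext fun U => by
    simp [φ, ψ, right_comm]
  exact congrArg (fun χ => χ a b c) h

/-- Attaching a tree in all possible ways to a given tree, as a derivation of `attach`. -/
noncomputable def graftTree : FreeNAPMagma X → TreeAlgebra k X →ₗ[k] TreeAlgebra k X := fun T =>
  (fold (fun x => (tree k (mk (FreeMagma.of x)), attach (tree k (mk (FreeMagma.of x)))))
    (fun a b => (attach a.1 b.1, attach.flip b.1 ∘ₗ a.2 + attach a.1 ∘ₗ b.2))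
    (fun a b c => by
      ext : 1
      · exact attach_right_comm _ _ _
      · refine LinearMap.ext fun s => ?_
        simp only [LinearMap.add_apply, LinearMap.comp_apply, LinearMap.flip_apply, map_add,
          attach_right_comm _ c.1 b.1, attach_right_comm a.1 (c.2 s) b.1,
          attach_right_comm a.1 c.1 (b.2 s)]
        abel) T).2

theorem graftTree_of (x : X) (s : TreeAlgebra k X) :
    graftTree (mk (FreeMagma.of x)) s = attach (tree k (mk (FreeMagma.of x))) s := rfl

/-- A vertex of `a * b` is a vertex of `a` or of `b`, whence the Leibniz rule. -/
theorem graftTree_mul (a b : FreeNAPMagma X) (s : TreeAlgebra k X) :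
    graftTree (a * b) s = attach (graftTree a s) (tree k b) + attach (tree k a) (graftTree b s) := by
  have h (T : FreeNAPMagma X) :
      (fold (fun x => (tree k (mk (FreeMagma.of x)), attach (tree k (mk (FreeMagma.of x)))))
        (fun a b => (attach a.1 b.1, attach.flip b.1 ∘ₗ a.2 + attach a.1 ∘ₗ b.2))
        (fun a b c => by
          ext : 1
          · exact attach_right_comm _ _ _
          · refine LinearMap.ext fun s => ?_
            simp only [LinearMap.add_apply, LinearMap.comp_apply, LinearMap.flip_apply, map_add,
              attach_right_comm _ c.1 b.1, attach_right_comm a.1 (c.2 s) b.1,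
              attach_right_comm a.1 c.1 (b.2 s)]
            abel) T).1 = tree k T := by
    induction T using ind with
    | of x => rfl
    | mul a b ha hb => rw [fold_mul, ha, hb, attach_tree]
  simp [graftTree, h]

noncomputable instance : Mul (TreeAlgebra k X) := ⟨fun a b => extend graftTree a b⟩

theorem mul_def (a b : TreeAlgebra k X) : a * b = extend graftTree a b := rfl

theorem tree_mul (T : FreeNAPMagma X) (a : TreeAlgebra k X) : tree k T * a = graftTree T a := by
  simp [mul_def]

noncomputable instance : NonUnitalNonAssocRing (TreeAlgebra k X) :=
  { (inferInstance : AddCommGroup (TreeAlgebra k X)), (inferInstance : Mul (TreeAlgebra k X)) with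
    left_distrib := fun a b c => by simp [mul_def]
    right_distrib := fun a b c => by simp [mul_def]
    zero_mul := fun a => by simp [mul_def]
    mul_zero := fun a => by simp [mul_def] }

instance : IsScalarTower k (TreeAlgebra k X) (TreeAlgebra k X) :=
  ⟨fun r a b => by simp [mul_def]⟩

instance : SMulCommClass k (TreeAlgebra k X) (TreeAlgebra k X) :=
  ⟨fun r a b => by simp [mul_def]⟩

theorem attach_mul (a b s : TreeAlgebra k X) :
    attach a b * s = attach (a * s) b + attach a (b * s) := by
  have h1 (T U : FreeNAPMagma X) : attach (tree k T) (tree k U) * s =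
      attach (tree k T * s) (tree k U) + attach (tree k T) (tree k U * s) := by
    rw [attach_tree, tree_mul, tree_mul, tree_mul, graftTree_mul]
  have h2 (T : FreeNAPMagma X) : LinearMap.mulRight k s ∘ₗ attach (tree k T) =
      attach (tree k T * s) + attach (tree k T) ∘ₗ LinearMap.mulRight k s :=
    hom_ext (h1 T)
  have h3 : LinearMap.mulRight k s ∘ₗ attach.flip b =
      attach.flip b ∘ₗ LinearMap.mulRight k s + attach.flip (b * s) :=
    hom_ext fun T => LinearMap.congr_fun (h2 T) b
  exact LinearMap.congr_fun h3 a

/-- Trees form a right-symmetric algebra. -/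
theorem right_symm (a b c : TreeAlgebra k X) :
    (a * b) * c - a * (b * c) = (a * c) * b - a * (c * b) := by
  -- Right multiplications are derivations of `attach`, hence so are their commutators and `L`, the
  -- defect of the identity. A derivation vanishing on single vertices is zero.
  let L : TreeAlgebra k X →ₗ[k] TreeAlgebra k X :=
    (LinearMap.mulRight k c ∘ₗ LinearMap.mulRight k b - LinearMap.mulRight k (b * c)) -
      (LinearMap.mulRight k b ∘ₗ LinearMap.mulRight k c - LinearMap.mulRight k (c * b))
  have hL : L = 0 := hom_ext fun T => by
    induction T using ind with
    | of x =>
      simp only [L, LinearMap.sub_apply, LinearMap.comp_apply, LinearMap.mulRight_apply,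
        LinearMap.zero_apply, tree_mul, graftTree_of, attach_mul]
      rw [attach_right_comm _ c b]
      abel
    | mul t u ht hu =>
      have e : L (tree k (t * u)) = attach (L (tree k t)) (tree k u) +
          attach (tree k t) (L (tree k u)) := by
        rw [← attach_tree]
        simp only [L, LinearMap.sub_apply, LinearMap.comp_apply, LinearMap.mulRight_apply,
          attach_mul, map_sub, add_mul]
        abel
      rw [e, ht, hu]
      simp
  have := congrArg (fun φ => φ a) hL
  exact sub_eq_zero.1 this

/-- `a` is the basis element of the tree `S`. -/
def IsTree (a : TreeAlgebra k X) (S : FreeNAPMagma X) : Prop := a = tree k S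

/-- The span of the trees smaller than `T`. -/
noncomputable def treesBelow (k : Type*) {X : Type*} [Field k] [Encodable X] (d : X → ℕ)
    (T : FreeNAPMagma X) : Submodule k (TreeAlgebra k X) :=
  belowSpan k d ∅ IsTree T

section Order

variable [Encodable X] {d : X → ℕ} {S T : FreeNAPMagma X} {a b : TreeAlgebra k X}

theorem tree_mem_treesBelow (h : Prec d S T) : tree k S ∈ treesBelow k d T :=
  mem_belowSpan (E := IsTree) rfl h

theorem treesBelow_mono (h : Prec d S T) : treesBelow k d S ≤ treesBelow k d T :=
  belowSpan_mono h

theorem treesBelow_le {N : Submodule k (TreeAlgebra k X)}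
    (h : ∀ S, Prec d S T → tree k S ∈ N) : treesBelow k d T ≤ N :=
  belowSpan_le (Set.empty_subset _) fun a S (e : a = tree k S) hS => by rw [e]; exact h S hS

theorem coeff_of_mem_treesBelow (h : Prec d S T ∨ S = T) (ha : a ∈ treesBelow k d S) :
    coeff T a = 0 := by
  have : treesBelow k d S ≤ LinearMap.ker (coeff (k := k) T) := by
    refine treesBelow_le fun U hU => coeff_tree_of_ne ?_
    rintro rfl
    rcases h with h | rfl
    · exact Prec.irrefl _ (hU.trans h)
    · exact Prec.irrefl _ hU
  exact this ha

theorem attach_mem_treesBelow (ha : a ∈ treesBelow k d S) (T : FreeNAPMagma X) :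
    attach a (tree k T) ∈ treesBelow k d (S * T) := by
  have : treesBelow k d S ≤ (treesBelow k d (S * T)).comap (attach.flip (tree k T)) :=
    treesBelow_le fun U hU => by
      rw [Submodule.mem_comap, LinearMap.flip_apply, attach_tree]
      exact tree_mem_treesBelow (hU.mul_right _)
  exact this ha

theorem attach_tree_mem_treesBelow (ha : a ∈ treesBelow k d S) (T : FreeNAPMagma X) :
    attach (tree k T) a ∈ treesBelow k d (T * S) := by
  have : treesBelow k d S ≤ (treesBelow k d (T * S)).comap (attach (tree k T)) :=
    treesBelow_le fun U hU => by
      rw [Submodule.mem_comap, attach_tree]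
      exact tree_mem_treesBelow (hU.mul_left _)
  exact this ha

/-- Grafting at the root dominates. By the Leibniz rule, the two parts of the product of `t * u`
with `S` lead with `t * S * u = t * u * S` and with the smaller `t * (u * S)`. -/
theorem tree_mul_tree_sub_mem (T S : FreeNAPMagma X) :
    tree k T * tree k S - tree k (T * S) ∈ treesBelow k d (T * S) := by
  induction T using ind with
  | of x => simp [tree_mul, graftTree_of]
  | mul t u ht hu =>
    have e : tree k (t * u) * tree k S - tree k (t * u * S) =
        attach (tree k t * tree k S - tree k (t * S)) (tree k u) +
        (attach (tree k t) (tree k u * tree k S - tree k (u * S)) + tree k (t * (u * S))) := by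
      rw [← attach_tree t u, attach_mul, right_comm t u S]
      simp only [map_sub, LinearMap.sub_apply, attach_tree]
      abel
    have h : Prec d (t * (u * S)) (t * u * S) := .mul_assoc _ _ _
    rw [e]
    refine add_mem ?_ (add_mem (treesBelow_mono h (attach_tree_mem_treesBelow hu t))
      (tree_mem_treesBelow h))
    rw [right_comm t u S]
    exact attach_mem_treesBelow ht u

theorem mul_sub_tree_mem (ha : a - tree k S ∈ treesBelow k d S)
    (hb : b - tree k T ∈ treesBelow k d T) : a * b - tree k (S * T) ∈ treesBelow k d (S * T) := by
  have h1 {U V : FreeNAPMagma X} (h : Prec d (U * V) (S * T)) :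
      tree k U * tree k V ∈ treesBelow k d (S * T) := by
    rw [← sub_add_cancel (tree k U * tree k V) (tree k (U * V))]
    exact add_mem (treesBelow_mono h (tree_mul_tree_sub_mem U V)) (tree_mem_treesBelow h)
  have h2 {c : TreeAlgebra k X} (hc : ∀ U, Prec d U S → tree k U * c ∈ treesBelow k d (S * T)) :
      (a - tree k S) * c ∈ treesBelow k d (S * T) := by
    have : treesBelow k d S ≤ (treesBelow k d (S * T)).comap (LinearMap.mulRight k c) :=
      treesBelow_le hc
    exact this ha
  have h3 {U : FreeNAPMagma X} (hU : ∀ V, Prec d V T → Prec d (U * V) (S * T)) :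
      tree k U * (b - tree k T) ∈ treesBelow k d (S * T) := by
    have : treesBelow k d T ≤ (treesBelow k d (S * T)).comap (LinearMap.mulLeft k (tree k U)) :=
      treesBelow_le fun V hV => h1 (hU V hV)
    exact this hb
  have e : a * b - tree k (S * T) = (a - tree k S) * (b - tree k T) + (a - tree k S) * tree k T +
      tree k S * (b - tree k T) + (tree k S * tree k T - tree k (S * T)) := by
    simp only [sub_mul, mul_sub]
    abel
  rw [e]
  exact add_mem (add_mem (add_mem
    (h2 fun U hU => h3 fun V hV => (hV.mul_left U).trans (hU.mul_right T))
    (h2 fun U hU => h1 (hU.mul_right T))) (h3 fun V hV => hV.mul_left S))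
    (tree_mul_tree_sub_mem S T)

end Order

/-- The algebra of trees with an identity element adjoined. -/
abbrev Unital (k X : Type*) [Field k] : Type _ := Unitization k (TreeAlgebra k X)

instance : IsScalarTower k (Unital k X) (Unital k X) :=
  ⟨fun r a b => by ext <;> simp [mul_assoc, mul_smul, smul_mul_assoc, smul_comm r]⟩

instance : SMulCommClass k (Unital k X) (Unital k X) :=
  ⟨fun r a b => by ext <;> simp [mul_left_comm, mul_smul, mul_smul_comm, smul_comm r]⟩

theorem Unital.right_symm (a b c : Unital k X) :
    (a * b) * c - a * (b * c) = (a * c) * b - a * (c * b) := by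
  rw [sub_eq_sub_iff_add_eq_add]
  ext
  · simp only [Unitization.fst_add, Unitization.fst_mul]
    ring
  · have h := TreeAlgebra.right_symm a.snd b.snd c.snd
    simp only [Unitization.snd_add, Unitization.snd_mul, Unitization.fst_mul, add_mul, mul_add,
      smul_mul_assoc, mul_smul_comm, smul_add]
    linear_combination (norm := module) h

/-- In the unital tree algebra the leading tree of the value of a word is the tree of the word. -/
theorem lift_sub_tree_mem [Encodable X] (d : X → ℕ) (w : FreeMagma X) :
    ∃ a : TreeAlgebra k X, FreeMagma.lift
      (fun x => (↑(tree k (mk (FreeMagma.of x))) : Unital k X)) w = a ∧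
      a - tree k (mk w) ∈ treesBelow k d (mk w) := by
  induction w with
  | ih1 x => exact ⟨tree k (mk (FreeMagma.of x)), rfl, by simp⟩
  | ih2 u v hu hv =>
    obtain ⟨a, ha, hu⟩ := hu
    obtain ⟨b, hb, hv⟩ := hv
    refine ⟨a * b, by rw [map_mul, ha, hb, Unitization.inr_mul], ?_⟩
    rw [map_mul]
    exact mul_sub_tree_mem hu hv

end TreeAlgebra

/-! ### The Freiheitssatz -/

namespace FreeRightSymmetricAlgebra

variable {k X : Type*} [Field k]

instance : IsScalarTower k (FreeRightSymmetricAlgebra k X) (FreeRightSymmetricAlgebra k X) :=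
  ⟨by
    rintro r ⟨a⟩ ⟨b⟩
    exact congrArg (RingCon.toQuotient (c := ringConGen (RightSymmetricRel k X)))
      (smul_mul_assoc r a b)⟩

instance : SMulCommClass k (FreeRightSymmetricAlgebra k X) (FreeRightSymmetricAlgebra k X) :=
  ⟨by
    rintro r ⟨a⟩ ⟨b⟩
    exact congrArg (RingCon.toQuotient (c := ringConGen (RightSymmetricRel k X)))
      (mul_smul_comm r a b).symm⟩

theorem toQuotient_single_coe (w : FreeMagma X) :
    RingCon.toQuotient (c := ringConGen (RightSymmetricRel k X))
      (MonoidAlgebra.single (w : WithOne (FreeMagma X)) 1) = FreeMagma.lift (var k) w := by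
  induction w with
  | ih1 x => rfl
  | ih2 u v hu hv =>
    rw [map_mul, ← hu, ← hv, ← RingCon.coe_mul, MonoidAlgebra.single_mul_single, mul_one,
      WithOne.coe_mul]

/-- The free right-symmetric algebra is spanned by `1` and the words in the variables. -/
theorem mem_span_words (a : FreeRightSymmetricAlgebra k X) :
    a ∈ Submodule.span k ({1} ∪ {h | ∃ S, IsWord (var k) h S}) := by
  obtain ⟨p⟩ := a
  change RingCon.toQuotient (c := ringConGen (RightSymmetricRel k X)) p ∈ _
  induction p using MonoidAlgebra.induction_linear with
  | zero => exact zero_mem _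
  | add p q hp hq => exact add_mem hp hq
  | single w r =>
    have h : RingCon.toQuotient (c := ringConGen (RightSymmetricRel k X))
        (MonoidAlgebra.single w r) = r • RingCon.toQuotient
          (c := ringConGen (RightSymmetricRel k X)) (MonoidAlgebra.single w 1) :=
      congrArg (RingCon.toQuotient (c := ringConGen (RightSymmetricRel k X)))
        ((MonoidAlgebra.smul_single' r w 1).trans (by rw [mul_one])).symm
    rw [h]
    refine Submodule.smul_mem _ _ (Submodule.subset_span ?_)
    induction w with
    | one => exact .inl rfl
    | coe w => exact .inr ⟨_, w, (toQuotient_single_coe w).symm, rfl⟩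

/-- Every element of the ideal generated by `f` is a linear combination of products of `f` with
words. -/
theorem mem_span_multiples {f : FreeRightSymmetricAlgebra k X} (F : FreeNAPMagma X)
    {a : FreeRightSymmetricAlgebra k X} (ha : a ∈ TwoSidedIdeal.span {f}) :
    a ∈ Submodule.span k (∅ ∪ {h | ∃ S, IsMultiple (var k) f F h S}) := by
  set N := Submodule.span k (∅ ∪ {h | ∃ S, IsMultiple (var k) f F h S})
  have hr (b c : FreeRightSymmetricAlgebra k X) (hb : b ∈ N) : b * c ∈ N := by
    have h1 (h : FreeRightSymmetricAlgebra k X) (hh : ∃ S, IsMultiple (var k) f F h S) :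
        h * c ∈ N := by
      have : Submodule.span k ({1} ∪ {h | ∃ S, IsWord (var k) h S}) ≤
          N.comap (LinearMap.mulLeft k h) := by
        refine Submodule.span_le.2 ?_
        obtain ⟨S, hS⟩ := hh
        rintro x (rfl | ⟨T, hT⟩)
        · change h * 1 ∈ N
          rw [mul_one]
          exact Submodule.subset_span (.inr ⟨S, hS⟩)
        · exact Submodule.subset_span (.inr ⟨_, hS.mul_right hT⟩)
      exact this (mem_span_words c)
    have : N ≤ N.comap (LinearMap.mulRight k c) :=
      Submodule.span_le.2 <| Set.union_subset (Set.empty_subset _) h1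
    exact this hb
  have hl (b c : FreeRightSymmetricAlgebra k X) (hb : b ∈ N) : c * b ∈ N := by
    have h1 (h : FreeRightSymmetricAlgebra k X) (hh : ∃ S, IsMultiple (var k) f F h S) :
        c * h ∈ N := by
      have : Submodule.span k ({1} ∪ {h | ∃ S, IsWord (var k) h S}) ≤
          N.comap (LinearMap.mulRight k h) := by
        refine Submodule.span_le.2 ?_
        obtain ⟨S, hS⟩ := hh
        rintro x (rfl | ⟨T, hT⟩)
        · change 1 * h ∈ N
          rw [one_mul]
          exact Submodule.subset_span (.inr ⟨S, hS⟩)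
        · exact Submodule.subset_span (.inr ⟨_, hS.mul_left hT⟩)
      exact this (mem_span_words c)
    have : N ≤ N.comap (LinearMap.mulLeft k c) :=
      Submodule.span_le.2 <| Set.union_subset (Set.empty_subset _) h1
    exact this hb
  induction ha using TwoSidedIdeal.span_induction with
  | mem x hx =>
    rw [Set.mem_singleton_iff.1 hx]
    exact Submodule.subset_span (.inr ⟨F, .refl⟩)
  | zero => exact zero_mem _
  | add x y _ _ hx hy => exact add_mem hx hy
  | neg x _ hx => exact neg_mem hx
  | left_absorb b x _ hx => exact hl _ _ hx
  | right_absorb b x _ hx => exact hr _ _ hx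

theorem IsWord.mem_varSubalgebra {d : X → ℕ} {s : Set X} (hs : ∀ x, d x = 0 → x ∈ s)
    {a : FreeRightSymmetricAlgebra k X} {T : FreeNAPMagma X} (ha : IsWord (var k) a T)
    (hT : weight d T = 0) : a ∈ varSubalgebra k s := by
  obtain ⟨w, rfl, rfl⟩ := ha
  induction w with
  | ih1 x => exact NonUnitalAlgebra.subset_adjoin k (.inr ⟨x, hs x hT, rfl⟩)
  | ih2 u v hu hv =>
    rw [map_mul, weight_mul, Nat.add_eq_zero_iff] at hT
    rw [map_mul]
    exact mul_mem (hu hT.1) (hv hT.2)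

theorem one_mem_varSubalgebra (s : Set X) : 1 ∈ varSubalgebra k s :=
  NonUnitalAlgebra.subset_adjoin k (.inl rfl)

variable [Encodable X]

/-- The coefficient of `T` in the image in the algebra of trees. It vanishes on smaller words. -/
theorem exists_coeff (k : Type*) [Field k] (d : X → ℕ) (T : FreeNAPMagma X) :
    ∃ φ : FreeRightSymmetricAlgebra k X →ₗ[k] k,
      (∀ a ∈ wordsBelow k d (var k) T, φ a = 0) ∧ ∀ a, IsWord (var k) a T → φ a = 1 := by
  obtain ⟨ψ, ⟨h1, hψ⟩, -⟩ := existsUnique_lift (k := k) TreeAlgebra.Unital.right_symm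
    fun x : X => (↑(TreeAlgebra.tree k (mk (FreeMagma.of x))) : TreeAlgebra.Unital k X)
  have hw (w : FreeMagma X) : ∃ a : TreeAlgebra k X, ψ (FreeMagma.lift (var k) w) = a ∧
      a - TreeAlgebra.tree k (mk w) ∈ TreeAlgebra.treesBelow k d (mk w) := by
    obtain ⟨a, ha, hm⟩ := TreeAlgebra.lift_sub_tree_mem (k := k) d w
    refine ⟨a, ?_, hm⟩
    rw [← ha]
    clear ha hm
    induction w with
    | ih1 x => exact hψ x
    | ih2 u v hu hv => rw [map_mul, map_mul, map_mul, hu, hv]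
  -- Only the tree component of the unitization is kept, so `φ` kills `1`.
  let φ : FreeRightSymmetricAlgebra k X →ₗ[k] k :=
    TreeAlgebra.coeff T ∘ₗ Unitization.sndHom k k (TreeAlgebra k X) ∘ₗ 
      { toFun := ψ, map_add' := map_add ψ, map_smul' := map_smul ψ }
  have hφ (w : FreeMagma X) {a : TreeAlgebra k X} (ha : ψ (FreeMagma.lift (var k) w) = a) :
      φ (FreeMagma.lift (var k) w) = TreeAlgebra.coeff T a := by
    change TreeAlgebra.coeff T (ψ _).snd = _
    rw [ha, Unitization.snd_inr]
  refine ⟨φ, ?_, ?_⟩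
  · have : wordsBelow k d (var k) T ≤ LinearMap.ker φ := by
      refine belowSpan_le ?_ ?_
      · rintro _ rfl
        change TreeAlgebra.coeff T (ψ 1).snd = 0
        rw [h1, Unitization.snd_one, map_zero]
      · rintro _ _ ⟨w, rfl, rfl⟩ hlt
        obtain ⟨a, ha, hm⟩ := hw w
        rw [LinearMap.mem_ker, hφ w ha, ← sub_add_cancel a (TreeAlgebra.tree k (mk w)), map_add,
          TreeAlgebra.coeff_of_mem_treesBelow (.inl hlt) hm, TreeAlgebra.coeff_tree_of_ne, add_zero]
        rintro rfl
        exact Prec.irrefl _ hlt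
    exact fun a ha => this ha
  · rintro _ ⟨w, rfl, rfl⟩
    obtain ⟨a, ha, hm⟩ := hw w
    rw [hφ w ha, ← sub_add_cancel a (TreeAlgebra.tree k (mk w)), map_add,
      TreeAlgebra.coeff_of_mem_treesBelow (.inr rfl) hm, TreeAlgebra.coeff_tree_self, zero_add]

/-- The subalgebra is spanned by `1` and words of weight zero, and weight is compared first. -/
theorem varSubalgebra_le_wordsBelow {d : X → ℕ} {s : Set X} (hs : ∀ x ∈ s, d x = 0)
    {T : FreeNAPMagma X} (hT : 0 < weight d T) {a : FreeRightSymmetricAlgebra k X}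
    (ha : a ∈ varSubalgebra k s) : a ∈ wordsBelow k d (var k) T := by
  have key : a ∈ Submodule.span k ({1} ∪ {h | ∃ S, IsWord (var k) h S ∧ weight d S = 0}) := by
    set N := Submodule.span k ({1} ∪ {h | ∃ S, IsWord (var k) h S ∧ weight d S = 0}) with hN
    induction ha using NonUnitalAlgebra.adjoin_induction with
    | mem x hx =>
      rcases hx with rfl | ⟨i, hi, rfl⟩
      · exact Submodule.subset_span (.inl rfl)
      · exact Submodule.subset_span (.inr ⟨_, ⟨FreeMagma.of i, rfl, rfl⟩, hs i hi⟩)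
    | zero => exact zero_mem _
    | add x y _ _ hx hy => exact add_mem hx hy
    | smul r x _ hx => exact Submodule.smul_mem _ _ hx
    | mul x y hx' hy' hx hy =>
      clear hx' hy'
      rw [hN] at hx hy
      induction hx, hy using Submodule.span_induction₂ with
      | mem_mem x y hx hy =>
        rcases hx with rfl | ⟨S, hS, hS'⟩
        · rw [one_mul]
          exact Submodule.subset_span hy
        · rcases hy with rfl | ⟨U, hU, hU'⟩
          · rw [mul_one]
            exact Submodule.subset_span (.inr ⟨S, hS, hS'⟩)
          · exact Submodule.subset_span (.inr ⟨_, hS.mul hU, by rw [weight_mul, hS', hU']⟩)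
      | zero_left y _ => rw [zero_mul]; exact zero_mem _
      | zero_right x _ => rw [mul_zero]; exact zero_mem _
      | add_left x y z _ _ _ h h' => rw [add_mul]; exact add_mem h h'
      | add_right x y z _ _ _ h h' => rw [mul_add]; exact add_mem h h'
      | smul_left r x y _ _ h => rw [smul_mul_assoc]; exact Submodule.smul_mem _ _ h
      | smul_right r x y _ _ h => rw [mul_smul_comm]; exact Submodule.smul_mem _ _ h
  refine Submodule.span_mono (Set.union_subset_union_right _ ?_) key
  rintro h ⟨S, hS, h0⟩
  exact ⟨S, hS, .of_weight_lt (by omega)⟩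

/-- The leading tree of an element outside of `varSubalgebra k s` involves a variable outside of
`s`. -/
theorem exists_leading_term_of_notMem [Nonempty X] {d : X → ℕ} {s : Set X} (hs : ∀ x, d x = 0 → x ∈ s)
    {f : FreeRightSymmetricAlgebra k X} (hf : f ∉ varSubalgebra k s) :
    ∃ c : k, c ≠ 0 ∧ ∃ b F, IsWord (var k) b F ∧ 0 < weight d F ∧
      f - c • b ∈ wordsBelow k d (var k) F := by
  obtain ⟨x⟩ := ‹Nonempty X›
  obtain ⟨T, hT⟩ := exists_mem_belowSpan (d := d) (mk (FreeMagma.of x)) (mem_span_words f)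
  rcases exists_leading_term (IsWord.sub_mem right_symm) T hT with h | ⟨c, hc, b, F, hb, -, h⟩
  · refine absurd ?_ hf
    have : Submodule.span k {1} ≤ (varSubalgebra k s).toSubmodule :=
      Submodule.span_le.2 (Set.singleton_subset_iff.2 (one_mem_varSubalgebra s))
    exact this h
  · refine ⟨c, hc, b, F, hb, Nat.pos_of_ne_zero fun h0 => hf ?_, h⟩
    have : wordsBelow k d (var k) F ≤ (varSubalgebra k s).toSubmodule := by
      refine belowSpan_le (Set.singleton_subset_iff.2 (one_mem_varSubalgebra s)) ?_
      intro a S ha hlt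
      refine IsWord.mem_varSubalgebra hs ha ?_
      -- A tree below one of weight zero has weight zero, so otherwise all of `f` would lie in the
      -- subalgebra.
      obtain ⟨B, hB⟩ := hlt.exists
      have := key_lt_key.1 hB
      omega
    rw [← sub_add_cancel f (c • b)]
    exact add_mem (this h) (SMulMemClass.smul_mem c (IsWord.mem_varSubalgebra hs hb h0))

/-- The Freiheitssatz for an arbitrary set of variables. -/
theorem eq_zero_of_mem_span_of_mem_varSubalgebra [Nonempty X] {s : Set X}
    {f : FreeRightSymmetricAlgebra k X}
    (hf : f ∉ varSubalgebra k s) {a : FreeRightSymmetricAlgebra k X}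
    (ha : a ∈ TwoSidedIdeal.span {f}) (has : a ∈ varSubalgebra k s) : a = 0 := by
  classical
  -- With this `d`, the weight counts the vertices labelled outside `s`.
  let d (x : X) : ℕ := if x ∈ s then 0 else 1
  obtain ⟨c, hc, b, F, hb, hF, hfb⟩ := exists_leading_term_of_notMem (d := d)
    (fun x hx => by by_contra h; simp [d, h] at hx) hf
  have hf' (b' : FreeRightSymmetricAlgebra k X) (hb' : IsWord (var k) b' F) :
      c⁻¹ • f - b' ∈ wordsBelow k d (var k) F := by
    have e : c⁻¹ • f - b' = c⁻¹ • (f - c • b) + (b - b') := by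
      rw [smul_sub, smul_smul, inv_mul_cancel₀ hc, one_smul]
      abel
    rw [e]
    exact add_mem (Submodule.smul_mem _ _ hfb) (IsWord.sub_mem right_symm _ _ _ hb hb')
  have ha' : a ∈ TwoSidedIdeal.span {c⁻¹ • f} := by
    refine (TwoSidedIdeal.span_le (I := TwoSidedIdeal.span {c⁻¹ • f})).2 ?_ ha
    rintro x (hx : x = f)
    -- A two-sided ideal absorbs ring elements, so the scalar `c` enters as `c • 1`.
    have h := (TwoSidedIdeal.span {c⁻¹ • f}).mul_mem_left (c • 1) _
      (TwoSidedIdeal.subset_span rfl)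
    rw [hx]
    rwa [smul_mul_smul_comm, one_mul, mul_inv_cancel₀ hc, one_smul] at h
  obtain ⟨T, hT⟩ := exists_mem_belowSpan (d := d) F (mem_span_multiples F ha')
  rcases exists_leading_term (IsMultiple.sub_mem right_symm hf') T hT with
    h | ⟨r, hr, h, S, hS, -, haS⟩
  · simpa using h
  exfalso
  -- The coefficient of `S` in `a` is computed twice: it is 0 because `a` lies in the subalgebra
  -- while `S` has positive weight, and it is `r` because `S` is the leading tree of `a`.
  obtain ⟨φ, hφ, hφ'⟩ := exists_coeff k d S
  have h1 : φ a = 0 := hφ a <| varSubalgebra_le_wordsBelow (fun x hx => by simp [d, hx])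
    (hF.trans_le (hS.occurs.weight_le d)) has
  have hle : multiplesBelow k d (var k) (c⁻¹ • f) F S ≤ wordsBelow k d (var k) S := by
    refine belowSpan_le (Set.empty_subset _) fun x U hx hU => ?_
    obtain ⟨y, hy⟩ := exists_isWord (var k) U
    rw [← sub_add_cancel x y]
    exact add_mem (belowSpan_mono hU (hx.sub_mem_wordsBelow right_symm hf' y hy))
      (mem_belowSpan hy hU)
  obtain ⟨y, hy⟩ := exists_isWord (var k) S
  have h2 : φ h = 1 := by
    rw [← sub_add_cancel h y, map_add, hφ _ (hS.sub_mem_wordsBelow right_symm hf' y hy), hφ' y hy,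
      zero_add]
  have h3 := hφ _ (hle haS)
  rw [map_sub, map_smul, h1, h2, smul_eq_mul, mul_one, zero_sub, neg_eq_zero] at h3
  exact hr h3

end FreeRightSymmetricAlgebra

theorem mainTheorem1 {k : Type*} [Field k] (n : ℕ)
    (f : FreeRightSymmetricAlgebra k (Fin (n + 1)))
    (hf : f ∉ FreeRightSymmetricAlgebra.varSubalgebra k {i : Fin (n + 1) | i ≠ Fin.last n}) :
    (TwoSidedIdeal.span {f} : Set (FreeRightSymmetricAlgebra k (Fin (n + 1)))) ∩
      (FreeRightSymmetricAlgebra.varSubalgebra k {i : Fin (n + 1) | i ≠ Fin.last n} :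
        Set (FreeRightSymmetricAlgebra k (Fin (n + 1)))) = {0} := by
  refine Set.Subset.antisymm ?_ ?_
  · rintro a ⟨ha, has⟩
    exact FreeRightSymmetricAlgebra.eq_zero_of_mem_span_of_mem_varSubalgebra hf ha has
  · rintro _ rfl
    exact ⟨zero_mem _, zero_mem _⟩
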